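/- Let $a$ be a point of a Riemann surface; fix a local coordinate $z=1/x$ vanishing at $a$, a direction $d$ at $a$, and a branch of $\log z$ near $d$. An *exponential factor* is a finite sum $q=\sum_k a_kx^k$ with $k\in\mathbb Q_{>0}$, $a_k\in\mathbb C$. The monodromy $\sigma$ acts by $\sigma(x^k)=e^{-2\pi i k}x^k$, and the *Stokes circle* $\langle q\rangle$ is the $\sigma$-orbit of $q$. Let $\mathrm{ram}(q)$ be the least common multiple of the denominators of the exponents of $q$, and $\mathrm{slope}(q)$ the largest exponent of $q$ ($\mathrm{slope}(0)=0$). An *irregular class* of rank $n$ is a finite multiset $\Theta=\sum n_iI_i$ of Stokes circles with $\sum n_i\,\mathrm{ram}(I_i)=n$. *Admissible deformations.* A *full irregular type* of rank $n$ is a list $Q=(q_1,\dots,q_n)$ of exponential factors that is closed under $\sigma$ (with multiplicities); its class $[Q]$ gives each circle $\langle p\rangle$ the number of times $p$ occurs in $Q$ as multiplicity. A family $(\Theta_b)_{b\in\mathbb B}$ of rank $n$ irregular classes over a connected complex manifold $\mathbb B$ is a (holomorphic) admissible deformation if locally on $\mathbb B$ one has $\Theta_b=[Q_b]$ for full irregular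 types $Q_b=(q_1,\dots,q_n)$ whose coefficients are holomorphic in $b$ and for which all $\mathrm{slope}(q_i-q_j)$ are independent of $b$. Two rank $n$ irregular classes are *admissible deformations of each other* if both are members of one such family. *Levels.* The levels $L(I)$ of a Stokes circle $I$ are the non-zero numbers $\mathrm{slope}(p-q)$ with $p,q\in I$. Write $L(I)=(k_1>\dots>k_m)$ and let $r_i$ be the least common multiple of the denominators of $k_1,\dots,k_i$. The admissible exponents of $I$ are $A(I)=\mathbb N_{>0}\cup\bigcup_i\bigl((0,k_i]\cap\tfrac1{r_i}\mathbb N\bigr)$. *Fission exponents.* Let $\tau_k$ discard all monomials of exponent $<k$. Given $p,q$, let $k$ be the smallest exponent of $p$ with $\langle\tau_kp\rangle=\langle\tau_kq\rangle$, and put $p_c=\tau_kp$, $q_c=\tau_kq$; if there is none put $p_c=q_c=0$. The fission exponent of $\langle p\rangle,\langle q\rangle$ is $\max(\mathrm{slope}(p-p_c),\mathrm{slope}(q-q_c))$; it depends only on the two circles. *Fission data.* Writing $\Theta=\sum_{i=1}^mI_i$ with the circles repeated according to multiplicity, the fission datum $\mathcal F(\Theta)$ consists of the multiset of the $L(I_i)$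 together with the fission exponents $f_{ij}$ of $I_i,I_j$, where data that differ by a relabelling of $\{1,\dots,m\}$ are equal. *Fission trees.* Let $A(\Theta)$ be the union of the $A(I)$ over the distinct circles $I$ in $\Theta$. The fission tree $\mathcal T(\Theta)$ is obtained by taking one full branch $\mathbb R_{\ge0}$ for each distinct circle $I$ in $\Theta$ and gluing the branches of $I$ and $J$ over $[g,\infty)$, where $g$ is the smallest element of $A(\Theta)$ larger than the fission exponent of $I,J$. It carries the height map $h$ to $\mathbb R_{\ge 0}$, the vertices $h^{-1}(\{0\}\cup A(\Theta))$, the admissible vertices (the points of the branches of the circles $I$ with height in $A(I)$), the mandatory vertices (those with height in $L(I)$), and for each leaf (point of height $0$) the multiplicity in $\Theta$ of its circle. Two fission trees are isomorphic if there is an isomorphism of metrised trees preserving all of these data. **Theorem.** Let $\Theta,\Theta'$ be irregular classes of rank $n$ at $a$. Then $\Theta,\Theta'$ are admissible deformations of each other if and only if their fission trees are isomorphic, $\mathcal T(\Theta)\cong\mathcal T(\Theta')$; and this holds if and only if their fission data are equal, $\mathcal F(\Theta)=\mathcal F(\Theta')$. -/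

import Mathlib

open scoped NNReal Manifold ContDiff

namespace FissionTrees

noncomputable section

/-! ### Exponential factors, monodromy and Stokes circles -/

/-- The possible exponents of the monomials of a Puiseux principal part: positive rationals. -/
abbrev Exponent : Type := {k : ℚ≥0 // 0 < k}

/-- Exponential factors: finite sums `q = ∑ a_k x ^ k` with `k ∈ ℚ_{>0}` and `a_k ∈ ℂ`
(Puiseux principal parts in `x = 1 / z`, for a fixed local coordinate `z`, direction `d` and
branch of `log z` near `d`). -/
abbrev ExpFactor : Type := Exponent →₀ ℂ

/-- The `m`-th power of the monodromy `σ`, where `σ (x ^ k) = exp (- 2 π i k) x ^ k`. -/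
def rotate (m : ℤ) (q : ExpFactor) : ExpFactor where
  support := q.support
  toFun k := Complex.exp (-(2 * Real.pi * Complex.I) * ((k : ℚ≥0) : ℂ) * m) * q k
  mem_support_toFun k := by simp [Complex.exp_ne_zero]

theorem rotate_apply (m : ℤ) (q : ExpFactor) (k : Exponent) :
    rotate m q k = Complex.exp (-(2 * Real.pi * Complex.I) * ((k : ℚ≥0) : ℂ) * m) * q k := rfl

theorem support_rotate (m : ℤ) (q : ExpFactor) : (rotate m q).support = q.support := rfl

theorem rotate_zero (q : ExpFactor) : rotate 0 q = q := by
  ext k; simp [rotate_apply]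

theorem rotate_rotate (m l : ℤ) (q : ExpFactor) : rotate m (rotate l q) = rotate (m + l) q := by
  ext k
  simp only [rotate_apply]
  rw [← mul_assoc, ← Complex.exp_add]
  push_cast
  ring_nf

theorem rotate_sub (m : ℤ) (p q : ExpFactor) : rotate m (p - q) = rotate m p - rotate m q := by
  ext k
  simp [rotate_apply, mul_sub]

/-- Being Galois conjugate, i.e. in the same orbit of the monodromy. -/
instance galoisSetoid : Setoid ExpFactor where
  r p q := ∃ m : ℤ, rotate m p = q
  iseqv :=
    { refl := fun p => ⟨0, rotate_zero p⟩
      symm := by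
        rintro p q ⟨m, rfl⟩
        exact ⟨-m, by rw [rotate_rotate, neg_add_cancel, rotate_zero]⟩
      trans := by
        rintro p q s ⟨m, rfl⟩ ⟨l, rfl⟩
        exact ⟨l + m, by rw [rotate_rotate]⟩ }

/-- Stokes circles, i.e. Galois orbits of exponential factors. -/
def StokesCircle : Type := Quotient galoisSetoid

/-- The Stokes circle `⟨q⟩`. -/
def circle (q : ExpFactor) : StokesCircle := Quotient.mk galoisSetoid q

theorem circle_eq_iff {p q : ExpFactor} : circle p = circle q ↔ ∃ m : ℤ, rotate m p = q :=
  Quotient.eq (r := galoisSetoid)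

theorem circle_rotate (m : ℤ) (q : ExpFactor) : circle (rotate m q) = circle q :=
  (circle_eq_iff.2 ⟨m, rfl⟩).symm

/-- The ramification order: the least common multiple of the denominators of the exponents. -/
def ExpFactor.ram (q : ExpFactor) : ℕ := q.support.lcm fun k => (k : ℚ≥0).den

/-- The ramification order of a Stokes circle. -/
def StokesCircle.ram : StokesCircle → ℕ :=
  Quotient.lift ExpFactor.ram (by rintro p q ⟨m, rfl⟩; rfl)

/-- The slope: the largest exponent occurring in `q`, with `slope 0 = 0`. -/
def slope (q : ExpFactor) : ℚ≥0 := q.support.sup fun k => (k : ℚ≥0)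

theorem slope_rotate (m : ℤ) (q : ExpFactor) : slope (rotate m q) = slope q := rfl

/-! ### Irregular classes and irregular types -/

/-- The rank `∑ n_i ram(I_i)` of a finite multiset `∑ n_i I_i` of Stokes circles. -/
def rank (Θ : StokesCircle →₀ ℕ) : ℕ := Θ.sum fun I m => m * I.ram

/-- Irregular classes of rank `n`: finite multisets `∑ n_i I_i` of Stokes circles, given by the
multiplicity function, with `∑ n_i ram(I_i) = n`. -/
abbrev IrregularClass (n : ℕ) : Type := {Θ : StokesCircle →₀ ℕ // rank Θ = n}

/-- Full irregular types of rank `n`: Galois closed lists `(q_1, …, q_n)`. -/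
structure FullIrregularType (n : ℕ) where
  /-- the entries of the list -/
  q : Fin n → ExpFactor
  galois_closed : ∃ π : Equiv.Perm (Fin n), ∀ i, rotate 1 (q i) = q (π i)

/-- `Θ = [Q]`: the multiplicity of each circle `⟨p⟩` in `Θ` is the number of times that `p`
appears in the list `Q`. -/
def FullIrregularType.HasClass {n : ℕ} (Q : FullIrregularType n) (Θ : IrregularClass n) : Prop :=
  ∀ p : ExpFactor, Θ.1 (circle p) = Nat.card {i : Fin n // Q.q i = p}

/-! ### Admissible deformations -/

/-- A family `b ↦ Θ_b` of irregular classes is a holomorphic admissible deformation if locally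
`Θ_b = [Q_b]` for a holomorphic family of full irregular types `Q_b = (q_1, …, q_n)` (all
coefficients are holomorphic in `b`) such that all `slope (q_i - q_j)` are independent of `b`. -/
def IsAdmissibleFamily {n : ℕ} (d : ℕ) {B : Type} [TopologicalSpace B]
    [ChartedSpace (EuclideanSpace ℂ (Fin d)) B] (Θ : B → IrregularClass n) : Prop :=
  ∀ b₀ : B, ∃ U : Set B, IsOpen U ∧ b₀ ∈ U ∧ ∃ Q : B → FullIrregularType n,
    (∀ (i : Fin n) (k : Exponent),
      MDifferentiableOn 𝓘(ℂ, EuclideanSpace ℂ (Fin d)) 𝓘(ℂ, ℂ) (fun b => (Q b).q i k) U) ∧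
    (∀ i j : Fin n, ∀ b ∈ U, ∀ b' ∈ U,
      slope ((Q b).q i - (Q b).q j) = slope ((Q b').q i - (Q b').q j)) ∧
    ∀ b ∈ U, (Q b).HasClass (Θ b)

/-- `Θ'` is an admissible deformation of `Θ`: both are members of a holomorphic admissible
deformation over some connected complex manifold. -/
def IsAdmissibleDeformation {n : ℕ} (Θ Θ' : IrregularClass n) : Prop :=
  ∃ (d : ℕ) (B : Type) (_ : TopologicalSpace B)
    (_ : ChartedSpace (EuclideanSpace ℂ (Fin d)) B),
    T2Space B ∧ SecondCountableTopology B ∧ ConnectedSpace B ∧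
    IsManifold 𝓘(ℂ, EuclideanSpace ℂ (Fin d)) ω B ∧
    ∃ F : B → IrregularClass n, IsAdmissibleFamily d F ∧ ∃ b₁ b₂ : B, F b₁ = Θ ∧ F b₂ = Θ'

/-! ### Levels and admissible exponents -/

/-- A level datum: a finite set `k_1 > ⋯ > k_m` of positive rationals with strictly increasing
common denominators `1 < r_1 < ⋯ < r_m`, where `r_i` is the least common multiple of the
denominators of `k_1, …, k_i`. In other words no denominator of a `k_i` divides the least common
multiple of the denominators of the larger elements. -/
structure LevelDatum where
  /-- the underlying finite set -/
  levels : Finset ℚ≥0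
  pos : ∀ k ∈ levels, 0 < k
  increasing : ∀ k ∈ levels, ¬ k.den ∣ {l ∈ levels | k < l}.lcm fun l => l.den

/-- The common denominator `r` of all elements `≥ k` of a level datum. -/
def LevelDatum.ramAt (L : LevelDatum) (k : ℚ≥0) : ℕ := {l ∈ L.levels | k ≤ l}.lcm fun l => l.den

/-- The admissible exponents `A(L) = ℕ_{>0} ∪ ⋃ᵢ ((0, k_i] ∩ r_i⁻¹ ℕ)` of `L = (k_1 > ⋯ > k_m)`. -/
def LevelDatum.admissible (L : LevelDatum) : Set ℚ≥0 :=
  {a | 0 < a ∧ ((∃ m : ℕ, a = m) ∨ ∃ k ∈ L.levels, a ≤ k ∧ ∃ m : ℕ, a = m / L.ramAt k)}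

/-- The levels of a Stokes circle: the non-zero slopes of the differences of its branches. -/
def levelSet (I : StokesCircle) : Set ℚ≥0 :=
  {s | ∃ p q : ExpFactor, circle p = I ∧ circle q = I ∧ slope (p - q) = s} \ {0}

theorem slope_mem {q : ExpFactor} (h : slope q ≠ 0) : ∃ k ∈ q.support, (k : ℚ≥0) = slope q := by
  have hne : q.support.Nonempty := by
    by_contra hn
    rw [Finset.not_nonempty_iff_eq_empty] at hn
    exact h (by simp [slope, hn])
  obtain ⟨k, hk, hk'⟩ := Finset.exists_mem_eq_sup q.support hne fun k => (k : ℚ≥0)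
  exact ⟨k, hk, hk'.symm⟩

theorem levelSet_circle {p : ExpFactor} {s : ℚ≥0} (h : s ∈ levelSet (circle p)) :
    ∃ k ∈ p.support, (k : ℚ≥0) = s ∧ ∃ m l : ℤ, rotate m p k ≠ rotate l p k ∧
      ∀ e : Exponent, s < e → rotate m p e = rotate l p e := by
  obtain ⟨⟨q, q', hq, hq', rfl⟩, h0⟩ := h
  obtain ⟨m, rfl⟩ := circle_eq_iff.1 hq.symm
  obtain ⟨l, rfl⟩ := circle_eq_iff.1 hq'.symm
  obtain ⟨k, hk, hks⟩ := slope_mem h0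
  have hk1 : rotate m p k ≠ rotate l p k := by
    simpa [sub_eq_zero] using hk
  refine ⟨k, ?_, hks, m, l, hk1, ?_⟩
  · rw [Finsupp.mem_support_iff]
    intro hp
    exact hk1 (by simp [rotate_apply, hp])
  · intro e he
    by_contra hne
    have : e ∈ (rotate m p - rotate l p).support := by
      simpa [sub_eq_zero] using hne
    exact absurd (Finset.le_sup (f := fun k : Exponent => (k : ℚ≥0)) this) (not_le.2 he)

theorem levelSet_finite (I : StokesCircle) : (levelSet I).Finite := by
  obtain ⟨p, rfl⟩ : ∃ p, circle p = I := Quotient.exists_rep I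
  refine (p.support.image fun k : Exponent => (k : ℚ≥0)).finite_toSet.subset fun s hs => ?_
  obtain ⟨k, hk, hks, -⟩ := levelSet_circle hs
  exact Finset.mem_coe.2 (Finset.mem_image.2 ⟨k, hk, hks⟩)

/-- Two monodromy powers agree on the monomial `x ^ k` exactly if the denominator of `k` divides
the difference. -/
theorem rotate_eq_iff {p : ExpFactor} {k : Exponent} (hk : k ∈ p.support) (m l : ℤ) :
    rotate m p k = rotate l p k ↔ ((k : ℚ≥0).den : ℤ) ∣ m - l := by
  have hk0 : p k ≠ 0 := by simpa using hk
  rw [rotate_apply, rotate_apply, mul_left_inj' hk0, Complex.exp_eq_exp_iff_exists_int]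
  have hpi : (2 * Real.pi * Complex.I : ℂ) ≠ 0 := by simp [Real.pi_ne_zero]
  have hcop : IsCoprime ((k : ℚ≥0).den : ℤ) ((k : ℚ≥0).num : ℤ) := by
    rw [Nat.isCoprime_iff_coprime]
    exact (k : ℚ≥0).coprime_num_den.symm
  have hden : ((k : ℚ≥0).den : ℂ) ≠ 0 := by exact_mod_cast (k : ℚ≥0).den_ne_zero
  have hcast : ((k : ℚ≥0) : ℂ) = (k : ℚ≥0).num / (k : ℚ≥0).den := NNRat.cast_def _
  constructor
  · rintro ⟨n, hn⟩
    have h1 : (((k : ℚ≥0).num : ℂ) * (m - l)) = (k : ℚ≥0).den * (-n) := by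
      rw [hcast] at hn
      have h2 : (2 * Real.pi * Complex.I : ℂ) *
          (((k : ℚ≥0).num : ℂ) * (m - l) - (k : ℚ≥0).den * (-n)) = 0 := by
        field_simp at hn
        linear_combination (-(2 * Real.pi * Complex.I : ℂ)) * hn
      exact sub_eq_zero.1 ((mul_eq_zero.1 h2).resolve_left hpi)
    have h3 : ((k : ℚ≥0).num : ℤ) * (m - l) = (k : ℚ≥0).den * (-n) := by exact_mod_cast h1
    exact hcop.dvd_of_dvd_mul_left ⟨_, h3⟩
  · rintro ⟨c, hc⟩
    refine ⟨-((k : ℚ≥0).num * c), ?_⟩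
    have hc' : (m : ℂ) = l + (k : ℚ≥0).den * c := by
      have : m = l + (k : ℚ≥0).den * c := by linarith
      exact_mod_cast this
    rw [hcast, hc']
    push_cast
    field_simp
    ring

/-- The level datum `L(I)` of a Stokes circle `I`. -/
def StokesCircle.levelDatum (I : StokesCircle) : LevelDatum where
  levels := (levelSet_finite I).toFinset
  pos k hk := pos_iff_ne_zero.2 ((levelSet_finite I).mem_toFinset.1 hk).2
  increasing k hk hdvd := by
    obtain ⟨p, rfl⟩ : ∃ p, circle p = I := Quotient.exists_rep I
    obtain ⟨k', hk', rfl, m, l, hne, heq⟩ := levelSet_circle ((levelSet_finite _).mem_toFinset.1 hk)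
    apply hne
    rw [rotate_eq_iff hk']
    refine dvd_trans (Int.natCast_dvd_natCast.2 hdvd) (Int.natCast_dvd.2 (Finset.lcm_dvd ?_))
    intro e he
    rw [Finset.mem_filter] at he
    obtain ⟨e', he', rfl, -⟩ := levelSet_circle ((levelSet_finite _).mem_toFinset.1 he.1)
    exact Int.natCast_dvd.1 ((rotate_eq_iff he' m l).1 (heq e' he.2))

/-! ### Fission exponents -/

/-- The truncation `τ_k`, discarding all monomials with exponent `< k`. -/
def trunc (k : Exponent) (q : ExpFactor) : ExpFactor := by
  classical exact q.filter fun e => k ≤ e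

theorem trunc_rotate (k : Exponent) (m : ℤ) (q : ExpFactor) :
    trunc k (rotate m q) = rotate m (trunc k q) := by
  classical
  ext e
  by_cases h : k ≤ e <;> simp [trunc, rotate_apply, h]

theorem circle_trunc_rotate (k : Exponent) (m : ℤ) (q : ExpFactor) :
    circle (trunc k (rotate m q)) = circle (trunc k q) := by
  rw [trunc_rotate, circle_rotate]

/-- The exponents `k` of `p` such that `⟨τ_k p⟩ = ⟨τ_k q⟩`. -/
def commonExponents (p q : ExpFactor) : Finset Exponent := by
  classical exact {k ∈ p.support | circle (trunc k p) = circle (trunc k q)}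

theorem commonExponents_rotate (m l : ℤ) (p q : ExpFactor) :
    commonExponents (rotate m p) (rotate l q) = commonExponents p q := by
  ext k
  simp only [commonExponents, Finset.mem_filter, circle_trunc_rotate, support_rotate]

theorem commonExponents_subset (p q : ExpFactor) :
    commonExponents p q ⊆ commonExponents q p := by
  classical
  intro k hk
  simp only [commonExponents, Finset.mem_filter] at hk ⊢
  refine ⟨?_, hk.2.symm⟩
  obtain ⟨m, hm⟩ := circle_eq_iff.1 hk.2
  have h1 : k ∈ (trunc k q).support := by
    rw [← hm, support_rotate]
    simpa [trunc] using hk.1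
  simpa [trunc] using h1

theorem commonExponents_comm (p q : ExpFactor) : commonExponents p q = commonExponents q p :=
  (commonExponents_subset p q).antisymm (commonExponents_subset q p)

/-- The common part `q_c` of `q`, cut out by a set `S` of exponents (which will be the common
exponents of `q` and another factor): the truncation of `q` at the minimum of `S`, or zero if `S`
is empty. -/
def commonPart (S : Finset Exponent) (q : ExpFactor) : ExpFactor :=
  if h : S.Nonempty then trunc (S.min' h) q else 0

theorem commonPart_rotate (S : Finset Exponent) (m : ℤ) (q : ExpFactor) :
    commonPart S (rotate m q) = rotate m (commonPart S q) := by
  unfold commonPart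
  split_ifs
  · exact trunc_rotate _ _ _
  · ext k; simp [rotate_apply]

/-- The fission exponent of two exponential factors: the larger of the slopes of their different
parts `p - p_c` and `q - q_c`. -/
def ExpFactor.fissionExponent (p q : ExpFactor) : ℚ≥0 :=
  max (slope (p - commonPart (commonExponents p q) p))
    (slope (q - commonPart (commonExponents p q) q))

/-- The fission exponent of two Stokes circles. -/
def StokesCircle.fissionExponent : StokesCircle → StokesCircle → ℚ≥0 :=
  Quotient.lift₂ ExpFactor.fissionExponent (by
    rintro p q _ _ ⟨m, rfl⟩ ⟨l, rfl⟩
    simp only [ExpFactor.fissionExponent, commonExponents_rotate, commonPart_rotate, ← rotate_sub,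
      slope_rotate])

theorem StokesCircle.fissionExponent_comm (I J : StokesCircle) :
    I.fissionExponent J = J.fissionExponent I := by
  induction I, J using Quotient.inductionOn₂ with
  | _ p q =>
    change ExpFactor.fissionExponent p q = ExpFactor.fissionExponent q p
    simp only [ExpFactor.fissionExponent, commonExponents_comm q p]
    exact max_comm _ _

/-! ### Fission data -/

/-- A fission datum with a chosen labelling of its level data. -/
structure IndexedFissionDatum : Type 1 where
  /-- the labels -/
  ι : Type
  finite : Finite ι
  /-- the level data `L_i`, not necessarily distinct -/
  L : ι → LevelDatum
  /-- the fission exponents `f_ij` -/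
  f : ι → ι → ℚ≥0
  symm : ∀ i j, f i j = f j i

/-- Forgetting the labelling: identify data that differ by a relabelling. -/
instance fissionSetoid : Setoid IndexedFissionDatum where
  r D D' := ∃ e : D.ι ≃ D'.ι, (∀ i, D'.L (e i) = D.L i) ∧ ∀ i j, D'.f (e i) (e j) = D.f i j
  iseqv :=
    { refl := fun _ => ⟨Equiv.refl _, fun _ => rfl, fun _ _ => rfl⟩
      symm := by
        rintro D D' ⟨e, h1, h2⟩
        exact ⟨e.symm, fun i => by rw [← h1, e.apply_symm_apply], fun i j => by
          rw [← h2, e.apply_symm_apply, e.apply_symm_apply]⟩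
      trans := by
        rintro D D' D'' ⟨e, h1, h2⟩ ⟨e', h1', h2'⟩
        exact ⟨e.trans e', fun i => by simp [h1, h1'], fun i j => by simp [h2, h2']⟩ }

/-- A fission datum `(𝓛, f)`: a finite multiset `𝓛 = L_1 + ⋯ + L_m` of level data with fission
exponents `f_ij = f_ji ∈ ℚ_{≥0}`; the labelling is not part of the datum. -/
def FissionDatum : Type 1 := Quotient fissionSetoid

/-- The fission datum of `Θ = ∑ I_i` (each circle repeated according to its multiplicity):
`L_i = L(I_i)` and `f_ij` is the fission exponent of `I_i, I_j`. -/
def fissionDatum {n : ℕ} (Θ : IrregularClass n) : FissionDatum :=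
  Quotient.mk fissionSetoid
    { ι := Σ I : {I : StokesCircle // I ∈ Θ.1.support}, Fin (Θ.1 I)
      finite := inferInstance
      L := fun i => i.1.1.levelDatum
      f := fun i j => i.1.1.fissionExponent j.1.1
      symm := fun i j => StokesCircle.fissionExponent_comm i.1.1 j.1.1 }

/-! ### Fission trees -/

/-- The tuple `(𝓣, 𝕍, 𝔸, 𝕃, h, n)` of a metrised tree, its vertices, admissible vertices and
mandatory vertices, its height map, and the multiplicities of its leaves. The height map preserves
lengths, so the metric is determined by the topology and the heights and is not recorded. -/
structure HeightTree : Type 1 where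
  /-- the points of the tree -/
  carrier : Type
  /-- the topology of the tree -/
  top : TopologicalSpace carrier
  /-- vertices -/
  V : Set carrier
  /-- admissible vertices -/
  A : Set carrier
  /-- mandatory vertices -/
  L : Set carrier
  /-- the height map -/
  h : carrier → ℝ≥0
  /-- multiplicities of the leaves -/
  mult : {v : carrier // h v = 0} → ℕ

attribute [instance] HeightTree.top

/-- Isomorphisms of trees relating all the data. -/
structure HeightTree.Iso (T T' : HeightTree) where
  /-- the isomorphism of the underlying trees -/
  e : T.carrier ≃ₜ T'.carrier
  height : ∀ v, T'.h (e v) = T.h v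
  vertices : ∀ v, e v ∈ T'.V ↔ v ∈ T.V
  admissible : ∀ v, e v ∈ T'.A ↔ v ∈ T.A
  mandatory : ∀ v, e v ∈ T'.L ↔ v ∈ T.L
  mult : ∀ v : {v : T.carrier // T.h v = 0},
    T'.mult ⟨e v.1, (height v.1).trans v.2⟩ = T.mult v

section tree

variable {n : ℕ} (Θ : IrregularClass n)

/-- The disjoint union of the full branches, one copy of `ℝ_{≥0}` for each distinct circle. -/
abbrev Branches : Type := Σ _ : {I : StokesCircle // I ∈ Θ.1.support}, ℝ≥0

/-- The union `A(Θ)` of the sets of admissible exponents of the circles of `Θ`. -/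
def admissibleExponents : Set ℚ≥0 := ⋃ I ∈ Θ.1.support, I.levelDatum.admissible

/-- `g` is the gluing exponent of `I` and `J`: the smallest element of `A(Θ)` that is larger than
the fission exponent of `I` and `J`. -/
def IsGluingExponent (I J : StokesCircle) (g : ℚ≥0) : Prop :=
  IsLeast {a ∈ admissibleExponents Θ | I.fissionExponent J < a} g

/-- The full branches of `I` and `J` are glued over `[g, ∞)`, `g` being the gluing exponent. -/
def Glued (v w : Branches Θ) : Prop :=
  v.2 = w.2 ∧ ∃ g : ℚ≥0, IsGluingExponent Θ v.1.1 w.1.1 g ∧ (g : ℝ≥0) ≤ v.2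

/-- The points of the fission tree of `Θ`, with the quotient topology. -/
abbrev TreePoints : Type := Quot (Glued Θ)

/-- The height of a point of the fission tree. -/
def treeHeight : TreePoints Θ → ℝ≥0 := Quot.lift (fun v => v.2) fun _ _ hvw => hvw.1

/-- The fission tree `𝓣(Θ) = (𝓣, 𝕍, 𝔸, 𝕃, h, n)` of an irregular class `Θ`. -/
def fissionTree : HeightTree where
  carrier := TreePoints Θ
  top := inferInstance
  h := treeHeight Θ
  V := {v | treeHeight Θ v = 0 ∨ ∃ a ∈ admissibleExponents Θ, treeHeight Θ v = (a : ℝ≥0)}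
  A := Quot.mk (Glued Θ) '' {v | ∃ a ∈ v.1.1.levelDatum.admissible, v.2 = (a : ℝ≥0)}
  L := Quot.mk (Glued Θ) '' {v | ∃ a ∈ v.1.1.levelDatum.levels, v.2 = (a : ℝ≥0)}
  mult := fun v =>
    Quot.lift (fun w : Branches Θ => if w.2 = 0 then Θ.1 w.1.1 else 0) (by
      rintro v w ⟨hvw, g, hg, hgv⟩
      have hpos : 0 < v.2 :=
        lt_of_lt_of_le (NNRat.cast_pos.2 (lt_of_le_of_lt zero_le hg.1.2)) hgv
      have hw : w.2 ≠ 0 := hvw ▸ hpos.ne'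
      simp [hpos.ne', hw]) v.1

end tree

end

end FissionTrees

open FissionTrees

namespace FissionTrees

/-! ### Slopes -/

/-! The function `slope (p - q)` is an ultrametric on exponential factors, invariant under the
monodromy, and the fission exponent of two circles is the distance between the two orbits
(`StokesCircle.fissionExponent_le`, `StokesCircle.exists_slope_sub_eq`). Hence it is an ultrametric
on circles, and every relation in the theorem is compared with one notion: a bijection of the
distinct circles preserving multiplicities, level data and fission exponents (`CircleMatching`).

Equal fission data give a matching because two labels carry the same circle exactly if their fission
exponent is zero. An isomorphism of trees maps leaves to leaves. A branch is the only continuous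
section of the height map through its leaf, so branches go to branches, and their levels and gluing
heights are kept. A gluing height determines the fission exponent, since non-zero fission exponents
lie in `A(Θ)`.

In an admissible family the slopes of the `q_i - q_j`, together with a permutation describing the
monodromy, determine the matching. That permutation can be kept near each point, so the fission
datum is locally constant.

Conversely, both classes have representatives at which all fission exponents are attained at once.
On the complex line through two such systems all but finitely many points are again such systems:
the required vanishings are linear, and the required non-vanishings concern finitely many affine
functions of the parameter that are non-zero at `t = 0`. The slopes of all differences of conjugates
are functions of the level data and fission exponents alone (`Realizes.slope_rotate_sub_rotate`),
and ℂ minus a finite set is connected, so this line carries an admissible deformation. -/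

theorem slope_le_iff {q : ExpFactor} {s : ℚ≥0} :
    slope q ≤ s ↔ ∀ e : Exponent, s < e → q e = 0 := by
  rw [slope, Finset.sup_le_iff]
  refine ⟨fun h e he => ?_, fun h e he => ?_⟩
  · by_contra hne
    exact absurd (h e (Finsupp.mem_support_iff.2 hne)) (not_le.2 he)
  · by_contra hlt
    exact (Finsupp.mem_support_iff.1 he) (h e (not_le.1 hlt))

theorem le_slope {q : ExpFactor} {e : Exponent} (h : q e ≠ 0) : (e : ℚ≥0) ≤ slope q :=
  Finset.le_sup (f := fun k : Exponent => (k : ℚ≥0)) (Finsupp.mem_support_iff.2 h)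

theorem exists_slope_eq {q : ExpFactor} (h : slope q ≠ 0) :
    ∃ k : Exponent, q k ≠ 0 ∧ (k : ℚ≥0) = slope q := by
  obtain ⟨k, hk, h⟩ := slope_mem h
  exact ⟨k, Finsupp.mem_support_iff.1 hk, h⟩

theorem slope_zero : slope 0 = 0 := by simp [slope]

theorem slope_eq_zero_iff {q : ExpFactor} : slope q = 0 ↔ q = 0 := by
  refine ⟨fun h => ?_, fun h => by rw [h, slope_zero]⟩
  ext e
  exact slope_le_iff.1 h.le e e.2

theorem slope_sub_eq_zero_iff {p q : ExpFactor} : slope (p - q) = 0 ↔ p = q := by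
  rw [slope_eq_zero_iff, sub_eq_zero]

theorem slope_neg (q : ExpFactor) : slope (-q) = slope q := by
  simp [slope]

theorem slope_sub_comm (p q : ExpFactor) : slope (p - q) = slope (q - p) := by
  rw [← slope_neg, neg_sub]

theorem slope_add_le (p q : ExpFactor) : slope (p + q) ≤ max (slope p) (slope q) := by
  rw [slope_le_iff]
  intro e he
  rw [max_lt_iff] at he
  rw [Finsupp.add_apply, slope_le_iff.1 le_rfl e he.1, slope_le_iff.1 le_rfl e he.2, add_zero]

theorem slope_sub_le (p q r : ExpFactor) :
    slope (p - r) ≤ max (slope (p - q)) (slope (q - r)) := by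
  simpa using slope_add_le (p - q) (q - r)

/-- In an ultrametric triangle with two different sides the largest side is attained. -/
theorem slope_sub_eq_of_lt {p q r : ExpFactor} (h : slope (q - r) < slope (p - q)) :
    slope (p - r) = slope (p - q) := by
  refine le_antisymm ((slope_sub_le p q r).trans (max_le le_rfl h.le)) ?_
  rcases le_max_iff.1 (slope_sub_le p r q) with h' | h'
  · exact h'
  · rw [slope_sub_comm r q] at h'
    exact absurd h (not_lt.2 h')

theorem slope_rotate_sub_rotate (m : ℤ) (p q : ExpFactor) :
    slope (rotate m p - rotate m q) = slope (p - q) := by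
  rw [← rotate_sub, slope_rotate]

theorem slope_rotate_sub (m l : ℤ) (p q : ExpFactor) :
    slope (rotate m p - rotate l q) = slope (rotate (m - l) p - q) := by
  rw [← slope_rotate_sub_rotate l (rotate (m - l) p) q, rotate_rotate, add_sub_cancel]

theorem exists_circle_eq (I : StokesCircle) : ∃ p, circle p = I := Quotient.exists_rep I

/-! ### Fission exponents as distances of Stokes circles -/

theorem trunc_apply (k : Exponent) (q : ExpFactor) (e : Exponent) [Decidable (k ≤ e)] :
    trunc k q e = if k ≤ e then q e else 0 := by
  classical
  rw [trunc, Finsupp.filter_apply]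
  congr

theorem exists_rotate_commonPart (p q : ExpFactor) :
    ∃ m : ℤ, rotate m (commonPart (commonExponents p q) q) =
      commonPart (commonExponents p q) p := by
  classical
  unfold commonPart
  split_ifs with h
  · have hc : ∀ k ∈ commonExponents p q, circle (trunc k q) = circle (trunc k p) := by
      intro k hk
      rw [commonExponents, Finset.mem_filter] at hk
      exact hk.2.symm
    exact circle_eq_iff.1 (hc _ (Finset.min'_mem _ h))
  · exact ⟨0, rotate_zero 0⟩

/-- Rotate `q` so that the common parts coincide; then both factors lie within the fission exponent
of this one common part. -/
theorem exists_slope_sub_rotate_le (p q : ExpFactor) :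
    ∃ m : ℤ, slope (p - rotate m q) ≤ p.fissionExponent q := by
  obtain ⟨m, hm⟩ := exists_rotate_commonPart p q
  refine ⟨m, (slope_sub_le p (commonPart (commonExponents p q) p) _).trans ?_⟩
  refine max_le (le_max_left _ _) ?_
  rw [← hm, slope_rotate_sub_rotate, slope_sub_comm]
  exact le_max_right _ _

theorem slope_sub_commonPart_lt {p : ExpFactor} {S : Finset Exponent} {k : Exponent} (hk : k ∈ S)
    (hpos : slope (p - commonPart S p) ≠ 0) : slope (p - commonPart S p) < k := by
  classical
  obtain ⟨e, he, hes⟩ := exists_slope_eq hpos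
  rw [← hes]
  by_contra hle
  apply he
  have hS : S.Nonempty := ⟨k, hk⟩
  have : S.min' hS ≤ e := (Finset.min'_le S k hk).trans (not_lt.1 hle)
  rw [commonPart, dif_pos hS, Finsupp.sub_apply, trunc_apply, if_pos this, sub_self]

theorem exponent_slope_sub_commonPart {p : ExpFactor} {S : Finset Exponent} {k : Exponent}
    (hpos : slope (p - commonPart S p) = k) : p k ≠ 0 := by
  classical
  obtain ⟨e, he, hes⟩ := exists_slope_eq (hpos.trans_ne k.2.ne')
  obtain rfl : e = k := Subtype.ext (hes.trans hpos)
  intro h0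
  apply he
  rw [Finsupp.sub_apply, h0, zero_sub, neg_eq_zero]
  unfold commonPart
  split_ifs
  · rw [trunc_apply, h0, ite_self]
  · rfl

/-- Suppose `p` and `q` agree at all exponents from `k`, the fission exponent, upwards. As the
leading exponent of a different part, `k` occurs in both factors, so it is a common exponent. The
common parts then contain the monomial `x ^ k`, which cannot remain in a different part. -/
theorem fissionExponent_le_slope_sub (p q : ExpFactor) : p.fissionExponent q ≤ slope (p - q) := by
  classical
  by_contra hlt
  rw [not_le] at hlt
  set S := commonExponents p q with hS
  have hpos : 0 < p.fissionExponent q := bot_le.trans_lt hlt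
  let k : Exponent := ⟨p.fissionExponent q, hpos⟩
  have heq : ∀ e : Exponent, k ≤ e → p e = q e := fun e he =>
    sub_eq_zero.1 (slope_le_iff.1 le_rfl e (hlt.trans_le he) : (p - q) e = 0)
  have hk : slope (p - commonPart S p) = k ∨ slope (q - commonPart S q) = k := by
    rcases max_choice (slope (p - commonPart S p)) (slope (q - commonPart S q)) with h | h
    · exact Or.inl h.symm
    · exact Or.inr h.symm
  have hpk : p k ≠ 0 := by
    rcases hk with h | h
    · exact exponent_slope_sub_commonPart h
    · rw [heq k le_rfl]; exact exponent_slope_sub_commonPart h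
  have hkS : k ∈ S := by
    rw [hS, commonExponents, Finset.mem_filter]
    refine ⟨Finsupp.mem_support_iff.2 hpk, congrArg circle ?_⟩
    ext e
    rw [trunc_apply, trunc_apply]
    split_ifs with h
    · exact heq e h
    · rfl
  rcases hk with h | h
  · exact (slope_sub_commonPart_lt hkS (h.trans_ne k.2.ne')).ne h
  · exact (slope_sub_commonPart_lt hkS (h.trans_ne k.2.ne')).ne h

theorem StokesCircle.fissionExponent_le (p q : ExpFactor) :
    (circle p).fissionExponent (circle q) ≤ slope (p - q) :=
  fissionExponent_le_slope_sub p q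

/-- The distance of two orbits is attained from any given point of the first one, because the
monodromy acts by isometries. -/
theorem StokesCircle.exists_slope_sub_eq (p : ExpFactor) (J : StokesCircle) :
    ∃ q, circle q = J ∧ slope (p - q) = (circle p).fissionExponent J := by
  obtain ⟨q, rfl⟩ := exists_circle_eq J
  obtain ⟨m, hm⟩ := exists_slope_sub_rotate_le p q
  refine ⟨rotate m q, circle_rotate m q, le_antisymm hm ?_⟩
  rw [← circle_rotate m q]
  exact StokesCircle.fissionExponent_le _ _

theorem StokesCircle.fissionExponent_eq_zero_iff {I J : StokesCircle} :
    I.fissionExponent J = 0 ↔ I = J := by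
  obtain ⟨p, rfl⟩ := exists_circle_eq I
  constructor
  · intro h
    obtain ⟨q, rfl, hq⟩ := StokesCircle.exists_slope_sub_eq p J
    rw [slope_sub_eq_zero_iff.1 (hq.trans h)]
  · rintro rfl
    have := StokesCircle.fissionExponent_le p p
    rw [sub_self, slope_zero] at this
    exact le_antisymm this bot_le

theorem StokesCircle.fissionExponent_self (I : StokesCircle) : I.fissionExponent I = 0 :=
  StokesCircle.fissionExponent_eq_zero_iff.2 rfl

theorem StokesCircle.fissionExponent_triangle (I J K : StokesCircle) :
    I.fissionExponent K ≤ max (I.fissionExponent J) (J.fissionExponent K) := by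
  obtain ⟨p, rfl⟩ := exists_circle_eq I
  obtain ⟨q, rfl, hq⟩ := StokesCircle.exists_slope_sub_eq p J
  obtain ⟨r, rfl, hr⟩ := StokesCircle.exists_slope_sub_eq q K
  rw [← hq, ← hr]
  exact (StokesCircle.fissionExponent_le p r).trans (slope_sub_le p q r)

/-! ### Level data -/

theorem LevelDatum.ext_levels {L L' : LevelDatum} (h : L.levels = L'.levels) : L = L' := by
  cases L; cases L'; congr

theorem mem_levels_circle {p : ExpFactor} {s : ℚ≥0} :
    s ∈ (circle p).levelDatum.levels ↔ s ≠ 0 ∧ ∃ u : ℤ, slope (rotate u p - p) = s := by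
  change s ∈ (levelSet_finite (circle p)).toFinset ↔ _
  rw [Set.Finite.mem_toFinset]
  constructor
  · rintro ⟨⟨q, q', hq, hq', rfl⟩, h0⟩
    obtain ⟨m, rfl⟩ := circle_eq_iff.1 hq.symm
    obtain ⟨l, rfl⟩ := circle_eq_iff.1 hq'.symm
    exact ⟨h0, m - l, (slope_rotate_sub m l p p).symm⟩
  · rintro ⟨h0, u, hu⟩
    exact ⟨⟨rotate u p, p, circle_rotate u p, rfl, hu⟩, h0⟩

/-- The largest level whose denominator does not divide `u`, or zero. -/
noncomputable def LevelDatum.moved (L : LevelDatum) (u : ℤ) : ℚ≥0 := by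
  classical exact {k ∈ L.levels | ¬ ((k.den : ℤ) ∣ u)}.sup id

/-- The factors with level datum `L`: all levels occur, and the denominator of each exponent
divides the common denominator of the levels above it. -/
def LevelDatum.Adapted (L : LevelDatum) (p : ExpFactor) : Prop :=
  (∀ k : Exponent, (k : ℚ≥0) ∈ L.levels → p k ≠ 0) ∧
    ∀ k : Exponent, p k ≠ 0 → (k : ℚ≥0).den ∣ L.ramAt k

theorem rotate_sub_self_apply_eq_zero_iff {p : ExpFactor} {k : Exponent} {u : ℤ} (hk : p k ≠ 0) :
    (rotate u p - p) k = 0 ↔ ((k : ℚ≥0).den : ℤ) ∣ u := by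
  have := rotate_eq_iff (Finsupp.mem_support_iff.2 hk) u 0
  rwa [rotate_zero, sub_zero, ← sub_eq_zero, ← Finsupp.sub_apply] at this

theorem rotate_sub_self_apply_of_eq_zero {p : ExpFactor} {k : Exponent} (u : ℤ) (hk : p k = 0) :
    (rotate u p - p) k = 0 := by
  simp [rotate_apply, hk]

theorem LevelDatum.le_moved (L : LevelDatum) {u : ℤ} {k : ℚ≥0} (hk : k ∈ L.levels)
    (hu : ¬ ((k.den : ℤ) ∣ u)) : k ≤ L.moved u := by
  classical
  exact Finset.le_sup (f := id) (Finset.mem_filter.2 ⟨hk, hu⟩)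

theorem LevelDatum.moved_mem (L : LevelDatum) {u : ℤ} (h : L.moved u ≠ 0) :
    L.moved u ∈ L.levels ∧ ¬ (((L.moved u).den : ℤ) ∣ u) := by
  classical
  have hne : {k ∈ L.levels | ¬ ((k.den : ℤ) ∣ u)}.Nonempty := by
    by_contra hn
    rw [Finset.not_nonempty_iff_eq_empty] at hn
    exact h (by simp [LevelDatum.moved, hn])
  obtain ⟨k, hk, hk'⟩ := Finset.exists_mem_eq_sup _ hne id
  have : L.moved u = k := by simp only [LevelDatum.moved]; exact hk'
  rw [this]
  exact Finset.mem_filter.1 hk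

theorem LevelDatum.ramAt_dvd (L : LevelDatum) {k : ℚ≥0} {u : ℤ}
    (h : ∀ l ∈ L.levels, k ≤ l → (l.den : ℤ) ∣ u) : (L.ramAt k : ℤ) ∣ u := by
  refine Int.natCast_dvd.2 (Finset.lcm_dvd fun l hl => ?_)
  rw [Finset.mem_filter] at hl
  exact Int.natCast_dvd.1 (h l hl.1 hl.2)

/-- The power `u` of the monodromy fixes `x ^ e` exactly if the denominator of `e` divides `u`. This
denominator divides the lcm of those of the levels `≥ e`, so the largest moved exponent is a level.
-/
theorem LevelDatum.Adapted.slope_rotate_sub_self {L : LevelDatum} {p : ExpFactor}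
    (h : L.Adapted p) (u : ℤ) : slope (rotate u p - p) = L.moved u := by
  apply le_antisymm
  · rw [slope_le_iff]
    intro e he
    by_cases hp : p e = 0
    · exact rotate_sub_self_apply_of_eq_zero u hp
    · rw [rotate_sub_self_apply_eq_zero_iff hp]
      refine (Int.natCast_dvd_natCast.2 (h.2 e hp)).trans (L.ramAt_dvd fun l hl hel => ?_)
      by_contra hn
      exact absurd (L.le_moved hl hn) (not_le.2 (he.trans_le hel))
  · by_cases h0 : L.moved u = 0
    · rw [h0]; exact bot_le
    · obtain ⟨hm, hd⟩ := L.moved_mem h0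
      let k : Exponent := ⟨L.moved u, pos_iff_ne_zero.2 h0⟩
      have : (rotate u p - p) k ≠ 0 := by
        rw [Ne, rotate_sub_self_apply_eq_zero_iff (h.1 k hm)]
        exact hd
      exact le_slope this

theorem LevelDatum.exists_moved_eq (L : LevelDatum) {k : ℚ≥0} (hk : k ∈ L.levels) :
    ∃ u : ℤ, L.moved u = k := by
  -- This power fixes every level above `k`; by `increasing` it moves `k`.
  refine ⟨({l ∈ L.levels | k < l}.lcm fun l => l.den : ℕ), le_antisymm ?_ ?_⟩
  · by_contra hlt
    rw [not_le] at hlt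
    obtain ⟨hm, hd⟩ := L.moved_mem (bot_le.trans_lt hlt).ne'
    exact hd (Int.natCast_dvd_natCast.2
      (Finset.dvd_lcm (f := fun l : ℚ≥0 => l.den) (Finset.mem_filter.2 ⟨hm, hlt⟩)))
  · exact L.le_moved hk fun h => L.increasing k hk (Int.natCast_dvd_natCast.1 h)

theorem LevelDatum.Adapted.levelDatum_eq {L : LevelDatum} {p : ExpFactor} (h : L.Adapted p) :
    (circle p).levelDatum = L := by
  apply LevelDatum.ext_levels
  ext s
  rw [mem_levels_circle]
  simp only [h.slope_rotate_sub_self]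
  constructor
  · rintro ⟨h0, u, rfl⟩
    exact (L.moved_mem h0).1
  · intro hs
    exact ⟨(L.pos s hs).ne', L.exists_moved_eq hs⟩

theorem adapted_levelDatum (p : ExpFactor) : (circle p).levelDatum.Adapted p := by
  constructor
  · intro k hk
    rw [mem_levels_circle] at hk
    obtain ⟨h0, u, hu⟩ := hk
    obtain ⟨e, he, hes⟩ := exists_slope_eq (hu.trans_ne h0)
    obtain rfl : e = k := Subtype.ext (hes.trans hu)
    exact fun hp => he (rotate_sub_self_apply_of_eq_zero u hp)
  · intro k hk
    by_contra hd
    -- This power fixes all levels `≥ k`. If it moved `x ^ k`, the leading exponent of `rotate u p -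
    -- p` would be a level `≥ k` that it moves.
    set u : ℤ := ((circle p).levelDatum.ramAt k : ℤ) with hu
    have hku : (rotate u p - p) k ≠ 0 := by
      rw [Ne, rotate_sub_self_apply_eq_zero_iff hk, hu, Int.natCast_dvd_natCast]
      exact hd
    have hle := le_slope hku
    have h0 : slope (rotate u p - p) ≠ 0 := (k.2.trans_le hle).ne'
    obtain ⟨e, he, hes⟩ := exists_slope_eq h0
    have hmem : (e : ℚ≥0) ∈ (circle p).levelDatum.levels :=
      mem_levels_circle.2 ⟨e.2.ne', u, hes.symm⟩
    have hpe : p e ≠ 0 := fun hp => he (rotate_sub_self_apply_of_eq_zero u hp)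
    apply he
    rw [rotate_sub_self_apply_eq_zero_iff hpe, hu, Int.natCast_dvd_natCast]
    exact Finset.dvd_lcm (f := fun l : ℚ≥0 => l.den)
      (Finset.mem_filter.2 ⟨hmem, hle.trans hes.ge⟩)

theorem adapted_iff {L : LevelDatum} {p : ExpFactor} :
    L.Adapted p ↔ (circle p).levelDatum = L :=
  ⟨fun h => h.levelDatum_eq, fun h => h ▸ adapted_levelDatum p⟩

/-- The common denominator of all levels. -/
def LevelDatum.ram (L : LevelDatum) : ℕ := L.levels.lcm fun l => l.den

theorem LevelDatum.ram_ne_zero (L : LevelDatum) : L.ram ≠ 0 := by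
  rw [LevelDatum.ram, Ne, Finset.lcm_eq_zero_iff]
  rintro ⟨k, -, hk⟩
  exact k.den_ne_zero hk

theorem LevelDatum.ramAt_dvd_ram (L : LevelDatum) (k : ℚ≥0) : L.ramAt k ∣ L.ram :=
  Finset.lcm_mono (Finset.filter_subset _ _)

theorem LevelDatum.Adapted.ram_eq {L : LevelDatum} {p : ExpFactor} (h : L.Adapted p) :
    p.ram = L.ram := by
  apply Nat.dvd_antisymm
  · exact Finset.lcm_dvd fun k hk =>
      (h.2 k (Finsupp.mem_support_iff.1 hk)).trans (L.ramAt_dvd_ram _)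
  · exact Finset.lcm_dvd fun k hk =>
      Finset.dvd_lcm (f := fun k : Exponent => (k : ℚ≥0).den) (b := ⟨k, L.pos k hk⟩)
        (Finsupp.mem_support_iff.2 (h.1 ⟨k, L.pos k hk⟩ hk))

theorem StokesCircle.ram_eq (I : StokesCircle) : I.ram = I.levelDatum.ram := by
  obtain ⟨p, rfl⟩ := exists_circle_eq I
  exact (adapted_levelDatum p).ram_eq

theorem rotate_eq_rotate_iff {p : ExpFactor} {m l : ℤ} :
    rotate m p = rotate l p ↔ (p.ram : ℤ) ∣ m - l := by
  constructor
  · intro h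
    refine Int.natCast_dvd.2 (Finset.lcm_dvd fun k hk => Int.natCast_dvd.1 ?_)
    rw [← rotate_eq_iff hk, h]
  · intro h
    ext k
    by_cases hk : k ∈ p.support
    · rw [rotate_eq_iff hk]
      exact (Int.natCast_dvd_natCast.2
        (Finset.dvd_lcm (f := fun k : Exponent => (k : ℚ≥0).den) hk)).trans h
    · rw [Finsupp.notMem_support_iff] at hk
      simp [rotate_apply, hk]

theorem NNRat.exists_eq_div_of_den_dvd {a : ℚ≥0} {r : ℕ} (h : a.den ∣ r) (hr : r ≠ 0) :
    ∃ m : ℕ, a = m / r := by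
  obtain ⟨c, rfl⟩ := h
  have hc : (c : ℚ≥0) ≠ 0 := by
    rintro h0
    exact hr (by simp [Nat.cast_eq_zero.1 h0])
  refine ⟨a.num * c, ?_⟩
  push_cast
  rw [mul_div_mul_right _ _ hc, NNRat.num_div_den]

theorem LevelDatum.ramAt_ne_zero (L : LevelDatum) (k : ℚ≥0) : L.ramAt k ≠ 0 := fun h =>
  L.ram_ne_zero (Nat.eq_zero_of_zero_dvd (h ▸ L.ramAt_dvd_ram k))

theorem LevelDatum.Adapted.mem_admissible {L : LevelDatum} {p : ExpFactor} (h : L.Adapted p)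
    {k : Exponent} (hk : p k ≠ 0) : (k : ℚ≥0) ∈ L.admissible := by
  refine ⟨k.2, ?_⟩
  have hd := h.2 k hk
  by_cases hne : {l ∈ L.levels | (k : ℚ≥0) ≤ l}.Nonempty
  · right
    -- The levels `≥ k` are those `≥ l`, so both have the same common denominator. If there are
    -- none, the lcm is empty and `k` is an integer.
    set l := {l ∈ L.levels | (k : ℚ≥0) ≤ l}.min' hne with hl
    obtain ⟨hl1, hl2⟩ := Finset.mem_filter.1 (Finset.min'_mem _ hne)
    refine ⟨l, hl1, hl2, NNRat.exists_eq_div_of_den_dvd (hd.trans ?_) (L.ramAt_ne_zero l)⟩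
    refine Finset.lcm_dvd fun e he => Finset.dvd_lcm (f := fun l : ℚ≥0 => l.den) ?_
    exact Finset.mem_filter.2 ⟨(Finset.mem_filter.1 he).1, Finset.min'_le _ _ he⟩
  · left
    rw [Finset.not_nonempty_iff_eq_empty] at hne
    rw [LevelDatum.ramAt, hne, Finset.lcm_empty] at hd
    obtain ⟨m, hm⟩ := NNRat.exists_eq_div_of_den_dvd hd one_ne_zero
    exact ⟨m, by simpa using hm⟩

/-- Bounded denominators make the admissible exponents discrete, which is why gluing exponents
exist. -/
theorem LevelDatum.admissible_exists_nat (L : LevelDatum) {a : ℚ≥0} (ha : a ∈ L.admissible) :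
    ∃ m : ℕ, a * L.ram = m := by
  rcases ha.2 with ⟨m, rfl⟩ | ⟨k, -, -, m, rfl⟩
  · exact ⟨m * L.ram, by push_cast; rfl⟩
  · obtain ⟨c, hc⟩ := L.ramAt_dvd_ram k
    refine ⟨m * c, ?_⟩
    have : (L.ramAt k : ℚ≥0) ≠ 0 := Nat.cast_ne_zero.2 (L.ramAt_ne_zero k)
    rw [hc]
    push_cast
    field_simp

/-- Levels above the fission exponent are common to both circles. -/
theorem mem_levels_of_fissionExponent_lt {I J : StokesCircle} {t : ℚ≥0}
    (h : I.fissionExponent J < t) (ht : t ∈ I.levelDatum.levels) : t ∈ J.levelDatum.levels := by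
  obtain ⟨p, rfl⟩ := exists_circle_eq I
  obtain ⟨q, rfl, hq⟩ := StokesCircle.exists_slope_sub_eq p J
  rw [mem_levels_circle] at ht ⊢
  obtain ⟨h0, u, hu⟩ := ht
  refine ⟨h0, u, ?_⟩
  rw [← hq] at h
  -- Two isosceles triangles: passing from `p` to `q`, and from `rotate u p` to `rotate u q`,
  -- changes things only below `t`, so the same `u` yields the level `t` for `q`.
  have h1 : slope (rotate u p - q) = t := by
    rw [← hu]; exact slope_sub_eq_of_lt (hu ▸ h)
  have h2 : slope (q - rotate u q) = slope (q - rotate u p) := by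
    apply slope_sub_eq_of_lt
    rw [slope_rotate_sub_rotate, slope_sub_comm q, h1]
    exact h
  rw [slope_sub_comm, h2, slope_sub_comm, h1]

/-- The leading exponent of a difference occurs in one of the two factors. -/
theorem fissionExponent_mem_admissible {I J : StokesCircle} (h : I.fissionExponent J ≠ 0) :
    I.fissionExponent J ∈ I.levelDatum.admissible ∪ J.levelDatum.admissible := by
  obtain ⟨p, rfl⟩ := exists_circle_eq I
  obtain ⟨q, rfl, hq⟩ := StokesCircle.exists_slope_sub_eq p J
  obtain ⟨k, hk, hks⟩ := exists_slope_eq (hq.trans_ne h)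
  rw [← hq, ← hks]
  by_cases hp : p k = 0
  · right
    apply (adapted_levelDatum q).mem_admissible
    intro h0
    exact hk (by simp [hp, h0])
  · left
    exact (adapted_levelDatum p).mem_admissible hp

section
/-! ### Matchings of circles and fission data -/

/-- The distinct circles of an irregular class. -/
abbrev Circles {n : ℕ} (Θ : IrregularClass n) : Type := {I : StokesCircle // I ∈ Θ.1.support}

/-- A bijection between the distinct circles of two irregular classes that preserves
multiplicities, level data and fission exponents. -/
structure CircleMatching {n : ℕ} (Θ Θ' : IrregularClass n) where
  /-- the bijection -/
  e : Circles Θ ≃ Circles Θ'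
  mult : ∀ I, Θ'.1 (e I).1 = Θ.1 I.1
  levels : ∀ I, (e I).1.levelDatum = I.1.levelDatum
  fission : ∀ I J, (e I).1.fissionExponent (e J).1 = I.1.fissionExponent J.1

variable {n : ℕ} {Θ Θ' : IrregularClass n}

/-- The inverse matching. -/
def CircleMatching.symm (M : CircleMatching Θ Θ') : CircleMatching Θ' Θ where
  e := M.e.symm
  mult I := by rw [← M.mult, M.e.apply_symm_apply]
  levels I := by rw [← M.levels, M.e.apply_symm_apply]
  fission I J := by rw [← M.fission, M.e.apply_symm_apply, M.e.apply_symm_apply]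

theorem Circles.mult_pos (I : Circles Θ) : 0 < Θ.1 I.1 :=
  Nat.pos_of_ne_zero (Finsupp.mem_support_iff.1 I.2)

theorem Circles.fissionExponent_eq_zero_iff {I J : Circles Θ} :
    I.1.fissionExponent J.1 = 0 ↔ I = J := by
  rw [StokesCircle.fissionExponent_eq_zero_iff, Subtype.ext_iff]

theorem CircleMatching.fissionDatum_eq (M : CircleMatching Θ Θ') :
    fissionDatum Θ = fissionDatum Θ' :=
  Quotient.sound ⟨Equiv.sigmaCongr M.e fun I => finCongr (M.mult I).symm,
    fun i => M.levels i.1, fun i j => M.fission i.1 j.1⟩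

/-- Labels of the same circle are those with fission exponent zero, so a relabelling maps fibres
over circles to fibres, and the multiplicities are the fibre sizes. -/
theorem nonempty_circleMatching_of_fissionDatum_eq (h : fissionDatum Θ = fissionDatum Θ') :
    Nonempty (CircleMatching Θ Θ') := by
  obtain ⟨e, hL, hf⟩ := Quotient.exact h
  change (Σ I : Circles Θ, Fin (Θ.1 I)) ≃ (Σ I : Circles Θ', Fin (Θ'.1 I)) at e
  change ∀ i, (e i).1.1.levelDatum = i.1.1.levelDatum at hL
  change ∀ i j, (e i).1.1.fissionExponent (e j).1.1 = i.1.1.fissionExponent j.1.1 at hf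
  have hiff : ∀ x y, (e x).1 = (e y).1 ↔ x.1 = y.1 := fun x y => by
    rw [← Circles.fissionExponent_eq_zero_iff, hf, Circles.fissionExponent_eq_zero_iff]
  let s : (I : Circles Θ) → Σ I : Circles Θ, Fin (Θ.1 I) := fun I => ⟨I, ⟨0, I.mult_pos⟩⟩
  have hbij : Function.Bijective fun I => (e (s I)).1 := by
    constructor
    · intro I J hIJ
      exact (hiff (s I) (s J)).1 hIJ
    · intro J
      refine ⟨(e.symm ⟨J, ⟨0, J.mult_pos⟩⟩).1, ?_⟩
      have := (hiff (s (e.symm ⟨J, ⟨0, J.mult_pos⟩⟩).1) (e.symm ⟨J, ⟨0, J.mult_pos⟩⟩)).2 rfl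
      rwa [e.apply_symm_apply] at this
  refine ⟨⟨Equiv.ofBijective _ hbij, fun I => ?_, fun I => hL (s I), fun I J => hf (s I) (s J)⟩⟩
  have c : {x : Σ I : Circles Θ, Fin (Θ.1 I) // x.1 = I} ≃
      {x : Σ I : Circles Θ', Fin (Θ'.1 I) // x.1 = (e (s I)).1} :=
    e.subtypeEquiv fun x => (hiff x (s I)).symm
  have := Nat.card_congr (((Equiv.sigmaSubtype I).symm.trans c).trans (Equiv.sigmaSubtype _))
  simpa using this.symm

end

/-! ### Points of the fission tree -/

section
variable {n : ℕ} {Θ Θ' : IrregularClass n}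

theorem exists_natCast_of_mem_admissibleExponents (Θ : IrregularClass n) :
    ∃ N : ℕ, N ≠ 0 ∧ ∀ a ∈ admissibleExponents Θ, ∃ m : ℕ, a * N = m := by
  refine ⟨∏ I ∈ Θ.1.support, I.levelDatum.ram,
    Finset.prod_ne_zero_iff.2 fun I _ => I.levelDatum.ram_ne_zero, fun a ha => ?_⟩
  simp only [admissibleExponents, Set.mem_iUnion] at ha
  obtain ⟨I, hI, ha⟩ := ha
  obtain ⟨m, hm⟩ := I.levelDatum.admissible_exists_nat ha
  obtain ⟨c, hc⟩ := Finset.dvd_prod_of_mem (fun I : StokesCircle => I.levelDatum.ram) hI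
  refine ⟨m * c, ?_⟩
  rw [hc]
  push_cast
  rw [← mul_assoc, hm]

/-- After multiplication by a common denominator this is the well-ordering of ℕ. The circle `I`
ensures that `A(Θ)` contains the positive integers, hence is unbounded. -/
theorem exists_isGluingExponent (I : Circles Θ) (J J' : StokesCircle) :
    ∃ g, IsGluingExponent Θ J J' g := by
  classical
  obtain ⟨N, hN, hA⟩ := exists_natCast_of_mem_admissibleExponents Θ
  set f := J.fissionExponent J'
  have hex : ∃ m : ℕ, ∃ a ∈ admissibleExponents Θ, f < a ∧ a * N = m := by
    obtain ⟨k, hk⟩ := exists_nat_gt f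
    have hmem : (k : ℚ≥0) ∈ admissibleExponents Θ := by
      simp only [admissibleExponents, Set.mem_iUnion]
      exact ⟨I.1, I.2, bot_le.trans_lt hk, Or.inl ⟨k, rfl⟩⟩
    obtain ⟨m, hm⟩ := hA _ hmem
    exact ⟨m, _, hmem, hk, hm⟩
  obtain ⟨a, ha, hfa, hm⟩ := Nat.find_spec hex
  refine ⟨a, ⟨ha, hfa⟩, fun b hb => ?_⟩
  obtain ⟨m', hm'⟩ := hA b hb.1
  have h1 : Nat.find hex ≤ m' := Nat.find_min' hex ⟨b, hb.1, hb.2, hm'⟩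
  have h2 : a * N ≤ b * N := by rw [hm, hm']; exact_mod_cast h1
  exact le_of_mul_le_mul_right h2 (by positivity)

/-- The branches of `I` and `J` agree at height `t`. -/
def Joined (I J : Circles Θ) (t : ℝ≥0) : Prop :=
  I = J ∨ ∃ g, IsGluingExponent Θ I.1 J.1 g ∧ (g : ℝ≥0) ≤ t

theorem Joined.symm {I J : Circles Θ} {t : ℝ≥0} (h : Joined I J t) : Joined J I t := by
  rcases h with rfl | ⟨g, hg, hgt⟩
  · exact Or.inl rfl
  · refine Or.inr ⟨g, ?_, hgt⟩
    rwa [IsGluingExponent, StokesCircle.fissionExponent_comm]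

theorem Joined.mono {I J : Circles Θ} {s t : ℝ≥0} (h : Joined I J s) (hst : s ≤ t) :
    Joined I J t :=
  h.imp id fun ⟨g, hg, hgs⟩ => ⟨g, hg, hgs.trans hst⟩

/-- By the ultrametric inequality one of the two given gluing exponents exceeds the fission exponent
of `I` and `K`. -/
theorem Joined.trans {I J K : Circles Θ} {t : ℝ≥0} (h : Joined I J t) (h' : Joined J K t) :
    Joined I K t := by
  rcases h with rfl | ⟨g, hg, hgt⟩
  · exact h'
  rcases h' with rfl | ⟨g', hg', hgt'⟩
  · exact Or.inr ⟨g, hg, hgt⟩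
  obtain ⟨a, ha⟩ := exists_isGluingExponent I I.1 K.1
  refine Or.inr ⟨a, ha, ?_⟩
  rcases le_max_iff.1 (StokesCircle.fissionExponent_triangle I.1 J.1 K.1) with hle | hle
  · exact (NNRat.cast_le.2 (ha.2 ⟨hg.1.1, hle.trans_lt hg.1.2⟩)).trans hgt
  · exact (NNRat.cast_le.2 (ha.2 ⟨hg'.1.1, hle.trans_lt hg'.1.2⟩)).trans hgt'

/-- Branches are glued over closed half-lines, so the lower end is included. -/
theorem Joined.of_forall_gt {I J : Circles Θ} {t : ℝ≥0} (h : ∀ s, t < s → Joined I J s) :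
    Joined I J t := by
  obtain ⟨g, hg⟩ := exists_isGluingExponent I I.1 J.1
  by_cases hIJ : I = J
  · exact Or.inl hIJ
  refine Or.inr ⟨g, hg, le_of_forall_gt_imp_ge_of_dense fun s hs => ?_⟩
  obtain ⟨g', hg', hgs⟩ := (h s hs).resolve_left hIJ
  rwa [hg.unique hg']

theorem Joined.eq_of_zero {I J : Circles Θ} (h : Joined I J 0) : I = J := by
  rcases h with h | ⟨g, hg, hg0⟩
  · exact h
  · have : (0 : ℝ≥0) < g := NNRat.cast_pos.2 (bot_le.trans_lt hg.1.2)
    exact absurd hg0 (not_le.2 this)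

/-- The point of height `t` on the branch of `I`. -/
def treePoint (I : Circles Θ) (t : ℝ≥0) : TreePoints Θ := Quot.mk (Glued Θ) ⟨I, t⟩

theorem exists_eq_treePoint (v : TreePoints Θ) : ∃ I, v = treePoint I (treeHeight Θ v) := by
  obtain ⟨⟨I, t⟩, rfl⟩ := Quot.exists_rep v
  exact ⟨I, rfl⟩

/-- `Joined` is already an equivalence relation at each height, so the quotient makes no further
identifications. -/
theorem treePoint_eq_iff {I J : Circles Θ} {t : ℝ≥0} :
    treePoint I t = treePoint J t ↔ Joined I J t := by
  constructor
  · intro h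
    have key : ∀ v w : Branches Θ, Relation.EqvGen (Glued Θ) v w →
        v.2 = w.2 ∧ Joined v.1 w.1 v.2 := by
      intro v w hvw
      induction hvw with
      | rel v w h => exact ⟨h.1, Or.inr h.2⟩
      | refl v => exact ⟨rfl, Or.inl rfl⟩
      | symm v w _ ih => exact ⟨ih.1.symm, ih.1 ▸ ih.2.symm⟩
      | trans v w u _ _ ih ih' => exact ⟨ih.1.trans ih'.1, ih.2.trans (ih.1 ▸ ih'.2)⟩
    exact (key _ _ (Quot.eqvGen_exact h)).2
  · rintro (rfl | h)
    · rfl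
    · exact Quot.sound ⟨rfl, h⟩

theorem continuous_treePoint (I : Circles Θ) : Continuous (treePoint I) :=
  continuous_quot_mk.comp continuous_sigmaMk

/-- The vertex may be marked by another circle whose branch is glued there, but levels above the
fission exponent belong to both circles. -/
theorem treePoint_mem_mandatory_iff {I : Circles Θ} {t : ℝ≥0} :
    treePoint I t ∈ (fissionTree Θ).L ↔ ∃ a ∈ I.1.levelDatum.levels, t = (a : ℝ≥0) := by
  constructor
  · rintro ⟨⟨J, s⟩, ⟨a, ha, has⟩, h⟩
    have hst : s = t := congrArg (treeHeight Θ) h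
    subst hst
    refine ⟨a, ?_, has⟩
    rcases treePoint_eq_iff.1 h with rfl | ⟨g, hg, hgs⟩
    · exact ha
    · rw [show s = (a : ℝ≥0) from has, NNRat.cast_le] at hgs
      exact mem_levels_of_fissionExponent_lt (hg.1.2.trans_le hgs) ha
  · rintro ⟨a, ha, has⟩
    exact ⟨⟨I, t⟩, ⟨a, ha, has⟩, rfl⟩

theorem mult_of_eq_treePoint {I : Circles Θ}
    {v : {v : (fissionTree Θ).carrier // (fissionTree Θ).h v = 0}}
    (h : v.1 = treePoint I 0) : (fissionTree Θ).mult v = Θ.1 I.1 := by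
  obtain ⟨v, hv⟩ := v
  obtain rfl : v = treePoint I 0 := h
  exact if_pos rfl

open Classical in
/-- The distance of a point below height `t` to the component below height `t` of the branch of
`J`, cut off so that it vanishes at heights above `t` and on that component. -/
noncomputable def gapBelow (J : Circles Θ) (t : ℝ≥0) : TreePoints Θ → ℝ :=
  Quot.lift (fun v => if Joined v.1 J t then 0 else max 0 ((t : ℝ) - v.2)) (by
    rintro ⟨I, s⟩ ⟨K, s'⟩ ⟨hs, hg⟩
    obtain rfl : s = s' := hs
    change (if Joined I J t then (0 : ℝ) else max 0 ((t : ℝ) - s)) =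
      if Joined K J t then (0 : ℝ) else max 0 ((t : ℝ) - s)
    -- At heights `≥ t` the cut-off makes both values zero; below `t` glued branches are still
    -- joined at `t`, so they lie in the same component.
    rcases le_total t s with hts | hst
    · have : max 0 ((t : ℝ) - s) = 0 := max_eq_left (sub_nonpos.2 (NNReal.coe_le_coe.2 hts))
      rw [this, ite_self, ite_self]
    · have hIK : Joined I K t := Joined.mono (Or.inr hg) hst
      have : Joined I J t ↔ Joined K J t := ⟨hIK.symm.trans, hIK.trans⟩
      simp only [this])

open Classical in
theorem gapBelow_treePoint (I J : Circles Θ) (s t : ℝ≥0) :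
    gapBelow J t (treePoint I s) = if Joined I J t then 0 else max 0 ((t : ℝ) - s) := rfl

open Classical in
theorem continuous_gapBelow (J : Circles Θ) (t : ℝ≥0) : Continuous (gapBelow J t) := by
  refine continuous_quot_lift _ (continuous_sigma fun I => ?_)
  change Continuous fun s : ℝ≥0 => if Joined I J t then (0 : ℝ) else max 0 ((t : ℝ) - s)
  split_ifs
  · exact continuous_const
  · fun_prop

/-- A continuous section of the height map that starts at a leaf follows the branch of that
leaf. -/
theorem eq_treePoint_of_section {γ : ℝ≥0 → TreePoints Θ} (hγ : Continuous γ)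
    (hh : ∀ t, treeHeight Θ (γ t) = t) {J : Circles Θ} (h0 : γ 0 = treePoint J 0) (t : ℝ≥0) :
    γ t = treePoint J t := by
  have hpt : ∀ s, ∃ K, γ s = treePoint K s := fun s => by
    obtain ⟨K, hK⟩ := exists_eq_treePoint (γ s)
    exact ⟨K, by rwa [hh] at hK⟩
  have key : ∀ (s u : ℝ≥0), s < u → ∀ K, γ s = treePoint K s → Joined K J u := by
    intro s u hsu K hK
    by_contra hn
    have hsu' : (s : ℝ) < u := NNReal.coe_lt_coe.2 hsu
    -- Below height `u` the gap along `γ` is either `0` or `u - r`, never half of it. If `γ` left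
    -- the component of `J`, the intermediate value theorem would give a zero of `G`.
    let G : ℝ≥0 → ℝ := fun r => gapBelow J u (γ r) - ((u : ℝ) - r) / 2
    have hG : Continuous G := ((continuous_gapBelow J u).comp hγ).sub (by fun_prop)
    have hG0 : G 0 ≤ 0 := by
      have hJ : Joined J J u := Or.inl rfl
      simp only [G, h0, gapBelow_treePoint, hJ, if_true, NNReal.coe_zero]
      have := u.coe_nonneg
      linarith
    have hGs : 0 ≤ G s := by
      simp only [G, hK, gapBelow_treePoint, if_neg hn]
      have := le_max_right 0 ((u : ℝ) - s)
      linarith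
    obtain ⟨r, hr, hGr⟩ := intermediate_value_Icc (zero_le : 0 ≤ s) hG.continuousOn ⟨hG0, hGs⟩
    have hru : (r : ℝ) < u := (NNReal.coe_le_coe.2 hr.2).trans_lt hsu'
    obtain ⟨K', hK'⟩ := hpt r
    simp only [G, hK', gapBelow_treePoint] at hGr
    split_ifs at hGr
    · linarith
    · rw [max_eq_right (by linarith)] at hGr
      linarith
  obtain ⟨K, hK⟩ := hpt t
  rw [hK, treePoint_eq_iff]
  exact Joined.of_forall_gt fun u hu => key t u hu K hK

theorem admissibleExponents_eq_of_equiv (e : Circles Θ ≃ Circles Θ')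
    (h : ∀ I, (e I).1.levelDatum = I.1.levelDatum) :
    admissibleExponents Θ' = admissibleExponents Θ := by
  ext a
  simp only [admissibleExponents, Set.mem_iUnion]
  constructor
  · rintro ⟨J, hJ, ha⟩
    refine ⟨_, (e.symm ⟨J, hJ⟩).2, ?_⟩
    rwa [← h, e.apply_symm_apply]
  · rintro ⟨I, hI, ha⟩
    exact ⟨_, (e ⟨I, hI⟩).2, by rwa [h]⟩

/-- A fission exponent above `f` would be a non-zero element of `A(Θ)`, hence at least `g`, yet it
is smaller than its gluing exponent. Applied in both directions, this recovers fission exponents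
from gluing heights. -/
theorem fissionExponent_le_of_isGluingExponent {I J : Circles Θ} {f g : ℚ≥0}
    (hg : IsGluingExponent Θ I.1 J.1 g)
    (hf : ∀ a ∈ admissibleExponents Θ, f < a → g ≤ a) : I.1.fissionExponent J.1 ≤ f := by
  by_contra hlt
  rw [not_le] at hlt
  refine absurd (hf _ ?_ hlt) (not_le.2 hg.1.2)
  simp only [admissibleExponents, Set.mem_iUnion]
  rcases fissionExponent_mem_admissible (bot_le.trans_lt hlt).ne' with h | h
  · exact ⟨_, I.2, h⟩
  · exact ⟨_, J.2, h⟩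

/-! ### Isomorphisms of fission trees -/

/-- The homeomorphism underlying an isomorphism of fission trees. -/
def HeightTree.Iso.homeo (E : (fissionTree Θ).Iso (fissionTree Θ')) :
    TreePoints Θ ≃ₜ TreePoints Θ' := E.e

theorem HeightTree.Iso.treeHeight_homeo (E : (fissionTree Θ).Iso (fissionTree Θ'))
    (v : TreePoints Θ) : treeHeight Θ' (E.homeo v) = treeHeight Θ v := E.height v

theorem HeightTree.Iso.homeo_treePoint (E : (fissionTree Θ).Iso (fissionTree Θ'))
    {I : Circles Θ} {J : Circles Θ'} (h : E.homeo (treePoint I 0) = treePoint J 0) (t : ℝ≥0) :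
    E.homeo (treePoint I t) = treePoint J t :=
  eq_treePoint_of_section (γ := fun t => E.homeo (treePoint I t))
    (E.homeo.continuous.comp (continuous_treePoint I))
    (fun t => E.treeHeight_homeo (treePoint I t)) h t

theorem nonempty_circleMatching_of_iso (E : (fissionTree Θ).Iso (fissionTree Θ')) :
    Nonempty (CircleMatching Θ Θ') := by
  have hleaf : ∀ I : Circles Θ, ∃ J : Circles Θ', E.homeo (treePoint I 0) = treePoint J 0 := by
    intro I
    obtain ⟨J, hJ⟩ := exists_eq_treePoint (E.homeo (treePoint I 0))
    have h0 : treeHeight Θ' (E.homeo (treePoint I 0)) = 0 := E.treeHeight_homeo _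
    exact ⟨J, by rwa [h0] at hJ⟩
  choose φ hφ using hleaf
  have hmap : ∀ I t, E.homeo (treePoint I t) = treePoint (φ I) t :=
    fun I t => E.homeo_treePoint (hφ I) t
  have hjoin : ∀ I J t, Joined I J t ↔ Joined (φ I) (φ J) t := fun I J t => by
    rw [← treePoint_eq_iff, ← treePoint_eq_iff, ← hmap, ← hmap, E.homeo.injective.eq_iff]
  have hbij : Function.Bijective φ := by
    constructor
    · intro I J hIJ
      exact ((hjoin I J 0).2 (Or.inl hIJ)).eq_of_zero
    · intro J
      obtain ⟨I, hI⟩ := exists_eq_treePoint (E.homeo.symm (treePoint J 0))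
      have h0 : treeHeight Θ (E.homeo.symm (treePoint J 0)) = 0 := by
        have := E.treeHeight_homeo (E.homeo.symm (treePoint J 0))
        rw [E.homeo.apply_symm_apply] at this
        exact this.symm
      rw [h0, E.homeo.symm_apply_eq, hφ] at hI
      exact ⟨I, (treePoint_eq_iff.1 hI).eq_of_zero.symm⟩
  have hlev : ∀ I, (φ I).1.levelDatum = I.1.levelDatum := by
    intro I
    apply LevelDatum.ext_levels
    ext s
    have h1 : E.homeo (treePoint I s) ∈ _ ↔ _ := E.mandatory (treePoint I s)
    rw [hmap] at h1
    replace h1 := (treePoint_mem_mandatory_iff.symm.trans h1).trans treePoint_mem_mandatory_iff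
    simpa using h1
  let e := Equiv.ofBijective φ hbij
  have hA : admissibleExponents Θ' = admissibleExponents Θ :=
    admissibleExponents_eq_of_equiv e hlev
  refine ⟨⟨e, fun I => ?_, hlev, fun I J => ?_⟩⟩
  · have h1 := E.mult ⟨treePoint I 0, rfl⟩
    rwa [mult_of_eq_treePoint (hφ I), mult_of_eq_treePoint rfl] at h1
  · change (φ I).1.fissionExponent (φ J).1 = I.1.fissionExponent J.1
    by_cases hIJ : I = J
    · rw [hIJ, StokesCircle.fissionExponent_self, StokesCircle.fissionExponent_self]
    have hIJ' : φ I ≠ φ J := fun h => hIJ (hbij.1 h)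
    obtain ⟨g, hg⟩ := exists_isGluingExponent I I.1 J.1
    obtain ⟨g', hg'⟩ := exists_isGluingExponent (φ I) (φ I).1 (φ J).1
    -- Each pair of branches is joined at the gluing height of the other pair, so the two gluing
    -- exponents agree.
    obtain ⟨a, ha, hag⟩ := ((hjoin I J g).1 (Or.inr ⟨g, hg, le_rfl⟩)).resolve_left hIJ'
    obtain ⟨b, hb, hbg⟩ := ((hjoin I J g').2 (Or.inr ⟨g', hg', le_rfl⟩)).resolve_left hIJ
    rw [ha.unique hg', NNRat.cast_le] at hag
    rw [hb.unique hg, NNRat.cast_le] at hbg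
    obtain rfl := le_antisymm hag hbg
    apply le_antisymm
    · exact fissionExponent_le_of_isGluingExponent hg' fun a ha hfa => hg.2 ⟨hA ▸ ha, hfa⟩
    · exact fissionExponent_le_of_isGluingExponent hg fun a ha hfa => hg'.2 ⟨hA ▸ ha, hfa⟩

/-! ### Tree isomorphisms induced by matchings -/

theorem CircleMatching.isGluingExponent_iff (M : CircleMatching Θ Θ') (I J : Circles Θ) (g : ℚ≥0) :
    IsGluingExponent Θ' (M.e I).1 (M.e J).1 g ↔ IsGluingExponent Θ I.1 J.1 g := by
  rw [IsGluingExponent, IsGluingExponent, M.fission,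
    admissibleExponents_eq_of_equiv M.e M.levels]

/-- The map of fission trees induced by a matching. -/
def CircleMatching.treeMap (M : CircleMatching Θ Θ') : TreePoints Θ → TreePoints Θ' :=
  Quot.map (fun v => ⟨M.e v.1, v.2⟩) fun v w ⟨h, g, hg, hgv⟩ =>
    ⟨h, g, (M.isGluingExponent_iff v.1 w.1 g).2 hg, hgv⟩

theorem CircleMatching.continuous_treeMap (M : CircleMatching Θ Θ') : Continuous M.treeMap :=
  continuous_quot_lift _ (continuous_quot_mk.comp
    (continuous_sigma fun I => continuous_sigmaMk (σ := fun _ : Circles Θ' => ℝ≥0) (i := M.e I)))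

theorem CircleMatching.symm_treeMap_treeMap (M : CircleMatching Θ Θ') (v : TreePoints Θ) :
    M.symm.treeMap (M.treeMap v) = v := by
  obtain ⟨⟨I, t⟩, rfl⟩ := Quot.exists_rep v
  change Quot.mk (Glued Θ) ⟨M.e.symm (M.e I), t⟩ = _
  rw [M.e.symm_apply_apply]

theorem CircleMatching.treeHeight_treeMap (M : CircleMatching Θ Θ') (v : TreePoints Θ) :
    treeHeight Θ' (M.treeMap v) = treeHeight Θ v := by
  obtain ⟨⟨I, t⟩, rfl⟩ := Quot.exists_rep v
  rfl

theorem CircleMatching.treeMap_mem_vertices_iff (M : CircleMatching Θ Θ') (v : TreePoints Θ) :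
    M.treeMap v ∈ (fissionTree Θ').V ↔ v ∈ (fissionTree Θ).V := by
  change (treeHeight Θ' (M.treeMap v) = 0 ∨
    ∃ a ∈ admissibleExponents Θ', treeHeight Θ' (M.treeMap v) = (a : ℝ≥0)) ↔
    (treeHeight Θ v = 0 ∨ ∃ a ∈ admissibleExponents Θ, treeHeight Θ v = (a : ℝ≥0))
  rw [M.treeHeight_treeMap, admissibleExponents_eq_of_equiv M.e M.levels]

theorem CircleMatching.treeMap_mem_admissible (M : CircleMatching Θ Θ') {v : TreePoints Θ}
    (h : v ∈ (fissionTree Θ).A) : M.treeMap v ∈ (fissionTree Θ').A := by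
  obtain ⟨⟨I, t⟩, ⟨a, ha, hat⟩, rfl⟩ := h
  exact ⟨⟨M.e I, t⟩, ⟨a, by rwa [M.levels], hat⟩, rfl⟩

theorem CircleMatching.treeMap_mem_mandatory (M : CircleMatching Θ Θ') {v : TreePoints Θ}
    (h : v ∈ (fissionTree Θ).L) : M.treeMap v ∈ (fissionTree Θ').L := by
  obtain ⟨⟨I, t⟩, ⟨a, ha, hat⟩, rfl⟩ := h
  exact ⟨⟨M.e I, t⟩, ⟨a, by rwa [M.levels], hat⟩, rfl⟩

/-- The isomorphism of fission trees induced by a matching. -/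
def CircleMatching.treeIso (M : CircleMatching Θ Θ') : (fissionTree Θ).Iso (fissionTree Θ') where
  e :=
    { toFun := M.treeMap
      invFun := M.symm.treeMap
      left_inv := M.symm_treeMap_treeMap
      right_inv := M.symm.symm_treeMap_treeMap
      continuous_toFun := M.continuous_treeMap
      continuous_invFun := M.symm.continuous_treeMap }
  height := M.treeHeight_treeMap
  vertices := M.treeMap_mem_vertices_iff
  admissible v := ⟨fun h => M.symm_treeMap_treeMap v ▸ M.symm.treeMap_mem_admissible h,
    M.treeMap_mem_admissible⟩
  mandatory v := ⟨fun h => M.symm_treeMap_treeMap v ▸ M.symm.treeMap_mem_mandatory h,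
    M.treeMap_mem_mandatory⟩
  mult := by
    rintro ⟨v, hv⟩
    obtain ⟨I, hI⟩ := exists_eq_treePoint v
    have hv' : treeHeight Θ v = 0 := hv
    rw [hv'] at hI
    subst hI
    rw [mult_of_eq_treePoint (I := I) rfl, mult_of_eq_treePoint (I := M.e I) rfl, M.mult]

end

/-! ### Fission data are constant in admissible deformations -/

section
variable {n : ℕ} {Θ Θ' : IrregularClass n}

theorem FullIrregularType.rotate_eq {Q : FullIrregularType n} {π : Equiv.Perm (Fin n)}
    (hπ : ∀ i, rotate 1 (Q.q i) = Q.q (π i)) (m : ℤ) (i : Fin n) :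
    rotate m (Q.q i) = Q.q ((π ^ m) i) := by
  induction m using Int.induction_on generalizing i with
  | zero => rw [rotate_zero]; rfl
  | succ m ih => rw [← rotate_rotate, hπ, ih, zpow_add_one, Equiv.Perm.mul_apply]
  | pred m ih =>
    have h1 : Q.q i = rotate 1 (Q.q (π⁻¹ i)) := by simp [hπ]
    rw [h1, rotate_rotate, sub_add_cancel, ih, zpow_sub_one, Equiv.Perm.mul_apply]

theorem FullIrregularType.HasClass.mem_support {Q : FullIrregularType n} (h : Q.HasClass Θ)
    (i : Fin n) : circle (Q.q i) ∈ Θ.1.support := by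
  rw [Finsupp.mem_support_iff, h]
  have : Nonempty {j : Fin n // Q.q j = Q.q i} := ⟨⟨i, rfl⟩⟩
  exact Nat.card_pos.ne'

/-- The circle of an entry of a full irregular type. -/
def FullIrregularType.HasClass.circleOf {Q : FullIrregularType n} (h : Q.HasClass Θ) (i : Fin n) :
    Circles Θ := ⟨circle (Q.q i), h.mem_support i⟩

theorem FullIrregularType.HasClass.circleOf_surjective {Q : FullIrregularType n}
    (h : Q.HasClass Θ) : Function.Surjective h.circleOf := by
  rintro ⟨I, hI⟩
  obtain ⟨p, rfl⟩ := exists_circle_eq I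
  rw [Finsupp.mem_support_iff, h] at hI
  obtain ⟨⟨i, hi⟩⟩ := (Nat.card_ne_zero.1 hI).1
  exact ⟨i, Subtype.ext (congrArg circle hi)⟩

/-- The distance of two orbits of `Q` is attained at some pair of entries; the pair of `Q'` with the
same indices lies in the corresponding orbits and has the same distance. -/
theorem FullIrregularType.fissionExponent_le_of_slope_sub_eq {Q Q' : FullIrregularType n}
    {π : Equiv.Perm (Fin n)} (hπ : ∀ i, rotate 1 (Q.q i) = Q.q (π i))
    (hπ' : ∀ i, rotate 1 (Q'.q i) = Q'.q (π i))
    (hs : ∀ i j, slope (Q.q i - Q.q j) = slope (Q'.q i - Q'.q j)) (i j : Fin n) :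
    (circle (Q'.q i)).fissionExponent (circle (Q'.q j)) ≤
      (circle (Q.q i)).fissionExponent (circle (Q.q j)) := by
  obtain ⟨r, hr, hrs⟩ := StokesCircle.exists_slope_sub_eq (Q.q i) (circle (Q.q j))
  obtain ⟨m, rfl⟩ := circle_eq_iff.1 hr.symm
  rw [← hrs, FullIrregularType.rotate_eq hπ, hs, ← FullIrregularType.rotate_eq hπ',
    ← circle_rotate m (Q'.q j)]
  exact StokesCircle.fissionExponent_le _ _

/-- Two full irregular types with the same monodromy permutation and the same slopes of
differences have matching circles. -/
theorem nonempty_circleMatching_of_slope_sub_eq {Q Q' : FullIrregularType n}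
    {π : Equiv.Perm (Fin n)} (hπ : ∀ i, rotate 1 (Q.q i) = Q.q (π i))
    (hπ' : ∀ i, rotate 1 (Q'.q i) = Q'.q (π i))
    (hs : ∀ i j, slope (Q.q i - Q.q j) = slope (Q'.q i - Q'.q j))
    (h : Q.HasClass Θ) (h' : Q'.HasClass Θ') : Nonempty (CircleMatching Θ Θ') := by
  have hf : ∀ i j, (h'.circleOf i).1.fissionExponent (h'.circleOf j).1 =
      (h.circleOf i).1.fissionExponent (h.circleOf j).1 := fun i j =>
    le_antisymm (FullIrregularType.fissionExponent_le_of_slope_sub_eq hπ hπ' hs i j)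
      (FullIrregularType.fissionExponent_le_of_slope_sub_eq hπ' hπ (fun i j => (hs i j).symm) i j)
  have hiff : ∀ i j, h'.circleOf i = h'.circleOf j ↔ h.circleOf i = h.circleOf j := fun i j => by
    rw [← Circles.fissionExponent_eq_zero_iff, hf, Circles.fissionExponent_eq_zero_iff]
  let s := Function.surjInv h.circleOf_surjective
  have hsc : ∀ I, h.circleOf (s I) = I := Function.surjInv_eq h.circleOf_surjective
  have hbij : Function.Bijective fun I => h'.circleOf (s I) := by
    constructor
    · intro I J hIJ
      rw [← hsc I, ← hsc J]
      exact (hiff _ _).1 hIJ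
    · intro J
      obtain ⟨i, rfl⟩ := h'.circleOf_surjective J
      exact ⟨h.circleOf i, (hiff _ _).2 (hsc _)⟩
  refine ⟨⟨Equiv.ofBijective _ hbij, fun I => ?_, fun I => ?_, fun I J => ?_⟩⟩
  · conv_rhs => rw [← hsc I]
    change Θ'.1 (circle (Q'.q (s I))) = Θ.1 (circle (Q.q (s I)))
    rw [h, h']
    refine Nat.card_congr (Equiv.subtypeEquivRight fun j => ?_)
    -- Equality of entries is the vanishing of a slope, so repetitions in the two lists agree.
    rw [← slope_sub_eq_zero_iff, ← hs, slope_sub_eq_zero_iff]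
  · conv_rhs => rw [← hsc I]
    apply LevelDatum.ext_levels
    ext t
    change t ∈ (circle (Q'.q (s I))).levelDatum.levels ↔ t ∈ (circle (Q.q (s I))).levelDatum.levels
    rw [mem_levels_circle, mem_levels_circle]
    simp only [FullIrregularType.rotate_eq hπ, FullIrregularType.rotate_eq hπ', hs]
  · conv_rhs => rw [← hsc I, ← hsc J]
    exact hf (s I) (s J)

theorem IsAdmissibleFamily.isLocallyConstant_fissionDatum {d : ℕ} {B : Type} [TopologicalSpace B]
    [ChartedSpace (EuclideanSpace ℂ (Fin d)) B] {F : B → IrregularClass n}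
    (hF : IsAdmissibleFamily d F) : IsLocallyConstant fun b => fissionDatum (F b) := by
  rw [IsLocallyConstant.iff_eventually_eq]
  intro b₀
  obtain ⟨U, hU, hb₀, Q, hQ, hs, hc⟩ := hF b₀
  have hcont : ∀ i k, ContinuousAt (fun b => (Q b).q i k) b₀ := fun i k =>
    (hQ i k).continuousOn.continuousAt (hU.mem_nhds hb₀)
  -- The permutation describing the monodromy may depend on `b`. Being described by `π` is a closed
  -- condition and there are finitely many `π`, so near `b₀` any permutation valid at `b` is valid
  -- at `b₀`.
  have hev : ∀ᶠ b in nhds b₀, ∀ π : Equiv.Perm (Fin n),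
      (∀ i, rotate 1 ((Q b).q i) = (Q b).q (π i)) →
        ∀ i, rotate 1 ((Q b₀).q i) = (Q b₀).q (π i) := by
    rw [Filter.eventually_all]
    intro π
    by_cases hπ : ∀ i, rotate 1 ((Q b₀).q i) = (Q b₀).q (π i)
    · exact Filter.Eventually.of_forall fun _ _ => hπ
    push Not at hπ
    obtain ⟨i, hi⟩ := hπ
    obtain ⟨k, hk⟩ : ∃ k, rotate 1 ((Q b₀).q i) k ≠ (Q b₀).q (π i) k := by
      by_contra hcon
      push Not at hcon
      exact hi (Finsupp.ext hcon)
    have h1 : ContinuousAt (fun b => rotate 1 ((Q b).q i) k) b₀ := by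
      simp only [rotate_apply]
      exact continuousAt_const.mul (hcont i k)
    filter_upwards [(h1.ne_iff_eventually_ne (hcont (π i) k)).1 hk] with b hb h
    exact absurd (DFunLike.congr_fun (h i) k) hb
  filter_upwards [hev, hU.mem_nhds hb₀] with b hb hbU
  obtain ⟨π, hπ⟩ := (Q b).galois_closed
  obtain ⟨M⟩ := nonempty_circleMatching_of_slope_sub_eq hπ (hb π hπ)
    (fun i j => hs i j b hbU b₀ hb₀) (hc b hbU) (hc b₀ hb₀)
  exact M.fissionDatum_eq

theorem IsAdmissibleDeformation.fissionDatum_eq (h : IsAdmissibleDeformation Θ Θ') :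
    fissionDatum Θ = fissionDatum Θ' := by
  obtain ⟨d, B, _, _, _, _, _, _, F, hF, b₁, b₂, rfl, rfl⟩ := h
  exact hF.isLocallyConstant_fissionDatum.apply_eq_of_preconnectedSpace b₁ b₂

end

/-! ### Compatible representatives -/

/-- Finitely many circles have representatives whose distances are the fission exponents. -/
theorem exists_compatible_representatives (s : Finset StokesCircle) :
    ∃ p : StokesCircle → ExpFactor, (∀ I, circle (p I) = I) ∧
      ∀ I ∈ s, ∀ J ∈ s, slope (p I - p J) = I.fissionExponent J := by
  classical
  induction s using Finset.induction_on with
  | empty => exact ⟨_, fun I => (exists_circle_eq I).choose_spec, by simp⟩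
  | insert J s hJ ih =>
    obtain ⟨p, hp, hs⟩ := ih
    obtain ⟨q, hq, hqs⟩ : ∃ q, circle q = J ∧ ∀ I ∈ s, slope (p I - q) = I.fissionExponent J := by
      rcases s.eq_empty_or_nonempty with rfl | hne
      · exact ⟨p J, hp J, by simp⟩
      -- It suffices to place `q` correctly relative to a circle `K` nearest to `J`: by minimality
      -- the fission exponent of `I` and `K` is at most that of `I` and `J`.
      obtain ⟨K, hK, hmin⟩ := s.exists_min_image (fun I => I.fissionExponent J) hne
      obtain ⟨q, hq, hqK⟩ := StokesCircle.exists_slope_sub_eq (p K) J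
      rw [hp] at hqK
      refine ⟨q, hq, fun I hI => le_antisymm ?_ ?_⟩
      · refine (slope_sub_le (p I) (p K) q).trans (max_le ?_ (hqK.trans_le (hmin I hI)))
        rw [hs I hI K hK]
        refine (StokesCircle.fissionExponent_triangle I J K).trans (max_le le_rfl ?_)
        rw [StokesCircle.fissionExponent_comm]
        exact hmin I hI
      · have := StokesCircle.fissionExponent_le (p I) q
        rwa [hp, hq] at this
    refine ⟨Function.update p J q, fun I => ?_, fun I hI I' hI' => ?_⟩
    · by_cases h : I = J
      · rw [h, Function.update_self, hq]
      · rw [Function.update_of_ne h, hp]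
    · rw [Finset.mem_insert] at hI hI'
      rcases hI with rfl | hI
      · rcases hI' with rfl | hI'
        · rw [sub_self, slope_zero, StokesCircle.fissionExponent_self]
        · have hne : I' ≠ I := by rintro rfl; exact hJ hI'
          rw [Function.update_self, Function.update_of_ne hne, slope_sub_comm, hqs I' hI',
            StokesCircle.fissionExponent_comm]
      · have hne : I ≠ J := by rintro rfl; exact hJ hI
        rcases hI' with rfl | hI'
        · rw [Function.update_self, Function.update_of_ne hne, hqs I hI]
        · have hne' : I' ≠ J := by rintro rfl; exact hJ hI'
          rw [Function.update_of_ne hne, Function.update_of_ne hne', hs I hI I' hI']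

/-- A family of factors with level data `L i` and fission exponents `f i j`, all of which are
attained without monodromy. -/
structure Realizes {ι : Type} (L : ι → LevelDatum) (f : ι → ι → ℚ≥0) (p : ι → ExpFactor) :
    Prop where
  adapted : ∀ i, (L i).Adapted (p i)
  slope_le : ∀ i j, slope (p i - p j) ≤ f i j
  le_slope : ∀ i j (u : ℤ), f i j ≤ slope (rotate u (p i) - p j)

/-- In the triangle `rotate u p`, `p`, `q` the first side is `L.moved u` and the second at most `f`.
If the first exceeds `f` the triangle is isosceles; otherwise `f` is both an upper and a lower
bound. -/
theorem slope_rotate_sub_eq_max {L : LevelDatum} {p q : ExpFactor} {f : ℚ≥0} {u : ℤ}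
    (hL : L.Adapted p) (hle : slope (p - q) ≤ f) (hge : f ≤ slope (rotate u p - q)) :
    slope (rotate u p - q) = max f (L.moved u) := by
  rw [← hL.slope_rotate_sub_self]
  rcases le_or_gt (slope (rotate u p - p)) f with h | h
  · rw [max_eq_left h]
    exact le_antisymm ((slope_sub_le _ p _).trans (max_le h hle)) hge
  · rw [max_eq_right h.le]
    exact slope_sub_eq_of_lt (hle.trans_lt h)

theorem Realizes.slope_rotate_sub_rotate {ι : Type} {L : ι → LevelDatum} {f : ι → ι → ℚ≥0}
    {p : ι → ExpFactor} (h : Realizes L f p) (i j : ι) (m l : ℤ) :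
    slope (rotate m (p i) - rotate l (p j)) = max (f i j) ((L i).moved (m - l)) := by
  rw [slope_rotate_sub]
  exact slope_rotate_sub_eq_max (h.adapted i) (h.slope_le i j) (h.le_slope i j _)

/-! ### The complex line through two realizations -/

/-- The point with parameter `t` on the line through `p` and `q`. -/
noncomputable def lineThrough (p q : ExpFactor) (t : ℂ) : ExpFactor := (1 - t) • p + t • q

theorem lineThrough_apply (p q : ExpFactor) (t : ℂ) (k : Exponent) :
    lineThrough p q t k = (1 - t) * p k + t * q k := by
  simp [lineThrough]

theorem lineThrough_zero (p q : ExpFactor) : lineThrough p q 0 = p := by simp [lineThrough]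

theorem lineThrough_one (p q : ExpFactor) : lineThrough p q 1 = q := by simp [lineThrough]

theorem rotate_lineThrough_sub_apply (u : ℤ) (p p' q q' : ExpFactor) (t : ℂ) (k : Exponent) :
    (rotate u (lineThrough p p' t) - lineThrough q q' t) k =
      (1 - t) * (rotate u p - q) k + t * (rotate u p' - q') k := by
  simp only [Finsupp.sub_apply, rotate_apply, lineThrough_apply]
  ring

/-- An affine function that is non-zero at `t = 0` has at most one zero. -/
theorem finite_affine_zeros {a : ℂ} (b : ℂ) (ha : a ≠ 0) :
    {t : ℂ | (1 - t) * a + t * b = 0}.Finite := by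
  refine Set.Subsingleton.finite fun t ht s hs => ?_
  rw [Set.mem_ofPred_eq] at ht hs
  have h1 : (t - s) * (b - a) = 0 := by linear_combination ht - hs
  rcases mul_eq_zero.1 h1 with h | h
  · exact sub_eq_zero.1 h
  · exact absurd (by linear_combination ht - t * h : a = 0) ha

/-- This leaves finitely many powers of the monodromy to control on the line. -/
theorem LevelDatum.Adapted.exists_lt_rotate_eq {L : LevelDatum} {p : ExpFactor} (h : L.Adapted p)
    (u : ℤ) : ∃ v < L.ram, rotate u p = rotate v p := by
  have hpos : (0 : ℤ) < L.ram := by exact_mod_cast Nat.pos_of_ne_zero L.ram_ne_zero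
  obtain ⟨v, hv⟩ := Int.eq_ofNat_of_zero_le (Int.emod_nonneg u hpos.ne')
  refine ⟨v, ?_, ?_⟩
  · have := Int.emod_lt_of_pos u hpos
    rw [hv] at this
    exact_mod_cast this
  · rw [rotate_eq_rotate_iff, h.ram_eq, ← hv]
    exact Int.dvd_self_sub_emod

section
variable {ι : Type} {L : ι → LevelDatum} {f : ι → ι → ℚ≥0} {p p' : ι → ExpFactor}

theorem LevelDatum.Adapted.lineThrough {L : LevelDatum} {p p' : ExpFactor} (h : L.Adapted p)
    (h' : L.Adapted p') {t : ℂ} (ht : ∀ k, p k ≠ 0 → lineThrough p p' t k ≠ 0) :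
    L.Adapted (lineThrough p p' t) := by
  refine ⟨fun k hk => ht k (h.1 k hk), fun k hk => ?_⟩
  by_cases h0 : p k = 0
  · refine h'.2 k fun h0' => hk ?_
    rw [lineThrough_apply, h0, h0', mul_zero, mul_zero, add_zero]
  · exact h.2 k h0

/-- All but finitely many points of the line through two realizations are realizations. -/
theorem Realizes.finite_not_realizes_lineThrough [Finite ι] (h : Realizes L f p)
    (h' : Realizes L f p') :
    {t : ℂ | ¬ Realizes L f fun i => lineThrough (p i) (p' i) t}.Finite := by
  -- The parameters to avoid: those killing a coefficient of some `p i`, or of a difference of a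
  -- conjugate of `p i` with `p j`.
  have hS : ((⋃ i, ⋃ k ∈ (p i).support, {t : ℂ | (1 - t) * p i k + t * p' i k = 0}) ∪
      ⋃ i, ⋃ j, ⋃ u ∈ Finset.range (L i).ram, ⋃ k ∈ (rotate (u : ℕ) (p i) - p j).support,
        {t : ℂ | (1 - t) * (rotate (u : ℕ) (p i) - p j) k +
          t * (rotate (u : ℕ) (p' i) - p' j) k = 0}).Finite := by
    refine Set.Finite.union (Set.finite_iUnion fun i => ?_)
      (Set.finite_iUnion fun i => Set.finite_iUnion fun j => ?_)
    · exact Set.Finite.biUnion (Finset.finite_toSet _) fun k hk =>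
        finite_affine_zeros _ (Finsupp.mem_support_iff.1 hk)
    · exact Set.Finite.biUnion (Finset.finite_toSet _) fun u _ =>
        Set.Finite.biUnion (Finset.finite_toSet _) fun k hk =>
          finite_affine_zeros _ (Finsupp.mem_support_iff.1 hk)
  refine hS.subset fun t ht => ?_
  by_contra hn
  apply ht
  rw [Set.mem_union, not_or] at hn
  have hn1 : ∀ i k, p i k ≠ 0 → (1 - t) * p i k + t * p' i k ≠ 0 := fun i k hk h0 =>
    hn.1 (Set.mem_iUnion.2 ⟨i, Set.mem_biUnion (Finsupp.mem_support_iff.2 hk) h0⟩)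
  have hn2 : ∀ i j, ∀ u < (L i).ram, ∀ k, (rotate u (p i) - p j) k ≠ 0 →
      (1 - t) * (rotate u (p i) - p j) k + t * (rotate u (p' i) - p' j) k ≠ 0 :=
    fun i j u hu k hk h0 => hn.2 (Set.mem_iUnion.2 ⟨i, Set.mem_iUnion.2 ⟨j,
      Set.mem_biUnion (Finset.mem_range.2 hu)
        (Set.mem_biUnion (Finsupp.mem_support_iff.2 hk) h0)⟩⟩)
  have had : ∀ i, (L i).Adapted (lineThrough (p i) (p' i) t) := fun i =>
    (h.adapted i).lineThrough (h'.adapted i) fun k hk => by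
      rw [lineThrough_apply]
      exact hn1 i k hk
  have hle : ∀ i j, slope (lineThrough (p i) (p' i) t - lineThrough (p j) (p' j) t) ≤ f i j := by
    intro i j
    rw [slope_le_iff]
    intro e he
    have h1 := rotate_lineThrough_sub_apply 0 (p i) (p' i) (p j) (p' j) t e
    rw [rotate_zero, rotate_zero, rotate_zero, slope_le_iff.1 (h.slope_le i j) e he,
      slope_le_iff.1 (h'.slope_le i j) e he, mul_zero, mul_zero, add_zero] at h1
    exact h1
  refine ⟨had, hle, fun i j u => ?_⟩
  obtain ⟨v, hv, huv⟩ := (had i).exists_lt_rotate_eq u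
  rw [huv]
  rcases eq_or_ne (f i j) 0 with h0 | h0
  · rw [h0]; exact bot_le
  -- If the moved level is at most `f i j`, the coefficient of exponent `f i j` is non-zero at `t =
  -- 0` and survives at `t`. Otherwise the isosceles triangle gives a slope above `f i j`.
  rcases le_or_gt ((L i).moved v) (f i j) with hm | hm
  · have hs : slope (rotate v (p i) - p j) = f i j := by
      rw [slope_rotate_sub_eq_max (h.adapted i) (h.slope_le i j) (h.le_slope i j _),
        max_eq_left hm]
    obtain ⟨k, hk, hks⟩ := exists_slope_eq (hs.trans_ne h0)
    rw [← hs, ← hks]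
    apply FissionTrees.le_slope
    rw [rotate_lineThrough_sub_apply]
    exact hn2 i j v hv k hk
  · rw [← (had i).slope_rotate_sub_self] at hm
    exact hm.le.trans (slope_sub_eq_of_lt ((hle i j).trans_lt hm)).ge

/-! ### Full irregular types of realizations -/

/-- The multiset in which the circle of `p i` is taken `N i` times. -/
noncomputable def classOf [Fintype ι] (N : ι → ℕ) (p : ι → ExpFactor) : StokesCircle →₀ ℕ :=
  ∑ i, Finsupp.single (circle (p i)) (N i)

theorem rank_classOf [Fintype ι] (N : ι → ℕ) (hp : ∀ i, (L i).Adapted (p i)) :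
    rank (classOf N p) = ∑ i, N i * (L i).ram := by
  rw [rank, classOf, ← Finsupp.sum_finsetSum_index (fun _ => zero_mul _)
    (fun _ _ _ => add_mul _ _ _)]
  refine Finset.sum_congr rfl fun i _ => ?_
  rw [Finsupp.sum_single_index (zero_mul _), StokesCircle.ram_eq, (hp i).levelDatum_eq]

theorem classOf_apply [Fintype ι] [DecidableEq StokesCircle] (N : ι → ℕ) (p : ι → ExpFactor)
    (I : StokesCircle) : classOf N p I = ∑ i, if circle (p i) = I then N i else 0 := by
  rw [classOf, Finsupp.finsetSum_apply]
  exact Finset.sum_congr rfl fun i _ => Finsupp.single_apply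

instance (M : LevelDatum) : NeZero M.ram := ⟨M.ram_ne_zero⟩

theorem LevelDatum.Adapted.rotate_eq_rotate_iff {M : LevelDatum} {q : ExpFactor}
    (h : M.Adapted q) {m l : ℤ} :
    rotate m q = rotate l q ↔ (m : ZMod M.ram) = (l : ZMod M.ram) := by
  rw [FissionTrees.rotate_eq_rotate_iff, h.ram_eq, ← ZMod.intCast_zmod_eq_zero_iff_dvd,
    Int.cast_sub, sub_eq_zero]

/-- The conjugates of the `p i`, each with `N i` copies. -/
noncomputable def conjugate (L : ι → LevelDatum) (N : ι → ℕ) (p : ι → ExpFactor)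
    (y : Σ i, Fin (N i) × ZMod (L i).ram) : ExpFactor := rotate y.2.2.val (p y.1)

/-- The full irregular type formed by `N i` copies of all conjugates of the `p i`, listed by
`E`. -/
noncomputable def conjugatesType {n : ℕ} (N : ι → ℕ)
    (E : (Σ i, Fin (N i) × ZMod (L i).ram) ≃ Fin n) (hp : ∀ i, (L i).Adapted (p i)) :
    FullIrregularType n where
  q x := conjugate L N p (E.symm x)
  galois_closed := by
    -- The monodromy adds `1` to the index of a conjugate, modulo the ramification order.
    refine ⟨(E.symm.trans (Equiv.sigmaCongrRight fun i =>
      Equiv.prodCongr (Equiv.refl _) (Equiv.addRight 1))).trans E, fun x => ?_⟩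
    obtain ⟨⟨i, a, z⟩, rfl⟩ := E.surjective x
    simp only [Equiv.trans_apply, Equiv.symm_apply_apply]
    change rotate 1 (rotate z.val (p i)) = rotate (z + 1).val (p i)
    rw [rotate_rotate, (hp i).rotate_eq_rotate_iff]
    push_cast
    rw [ZMod.natCast_zmod_val, ZMod.natCast_zmod_val, add_comm]

/-- The residues modulo the ramification order list each conjugate of `q` exactly once. -/
theorem sum_conjugates_eq [DecidableEq StokesCircle] [DecidableEq ExpFactor] {M : LevelDatum}
    {q : ExpFactor} (h : M.Adapted q) (r : ExpFactor) :
    (∑ z : ZMod M.ram, if rotate z.val q = r then 1 else 0) =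
      if circle q = circle r then 1 else 0 := by
  split_ifs with hc
  · obtain ⟨m, rfl⟩ := circle_eq_iff.1 hc
    simp only [h.rotate_eq_rotate_iff, Int.cast_natCast, ZMod.natCast_zmod_val]
    rw [Finset.sum_ite_eq' Finset.univ, if_pos (Finset.mem_univ _)]
  · refine Finset.sum_eq_zero fun z _ => if_neg fun hz => hc ?_
    rw [← hz, circle_rotate]

theorem conjugatesType_hasClass [Fintype ι] {n : ℕ} (N : ι → ℕ)
    (E : (Σ i, Fin (N i) × ZMod (L i).ram) ≃ Fin n) (hp : ∀ i, (L i).Adapted (p i))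
    (hn : rank (classOf N p) = n) :
    (conjugatesType N E hp).HasClass ⟨classOf N p, hn⟩ := by
  classical
  intro r
  rw [classOf_apply, Nat.card_eq_fintype_card, Fintype.card_subtype, Finset.card_filter,
    ← E.sum_comp, Fintype.sum_sigma]
  refine Finset.sum_congr rfl fun i _ => ?_
  simp only [conjugatesType, Equiv.symm_apply_apply]
  rw [Fintype.sum_prod_type]
  symm
  calc _ = ∑ _a : Fin (N i), if circle (p i) = circle r then 1 else 0 :=
        Finset.sum_congr rfl fun a _ => by
          convert sum_conjugates_eq (hp i) r
          rfl
    _ = _ := by simp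

/-- One enumeration `E` of all conjugates serves for every `b`, so the irregular type is global. Its
coefficients are constant multiples of those of `p b i`, and its slopes depend only on `L` and `f`.
-/
theorem isAdmissibleFamily_classOf [Fintype ι] {n d : ℕ} (N : ι → ℕ) {B : Type}
    [TopologicalSpace B] [ChartedSpace (EuclideanSpace ℂ (Fin d)) B] {p : B → ι → ExpFactor}
    (hp : ∀ b, Realizes L f (p b)) (hn : ∀ b, rank (classOf N (p b)) = n)
    (hN : ∑ i, N i * (L i).ram = n)
    (hhol : ∀ i k, MDifferentiable 𝓘(ℂ, EuclideanSpace ℂ (Fin d)) 𝓘(ℂ, ℂ) fun b => p b i k) :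
    IsAdmissibleFamily d fun b => (⟨classOf N (p b), hn b⟩ : IrregularClass n) := by
  intro b₀
  let E : (Σ i, Fin (N i) × ZMod (L i).ram) ≃ Fin n :=
    Fintype.equivFinOfCardEq (by simp [Fintype.card_sigma, ZMod.card, hN])
  refine ⟨Set.univ, isOpen_univ, Set.mem_univ _,
    fun b => conjugatesType N E (hp b).adapted, fun x k => ?_, fun x y b _ b' _ => ?_,
    fun b _ => conjugatesType_hasClass N E (hp b).adapted (hn b)⟩
  · exact (mdifferentiable_const.mul (hhol _ k)).mdifferentiableOn
  · exact ((hp b).slope_rotate_sub_rotate _ _ _ _).trans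
      ((hp b').slope_rotate_sub_rotate _ _ _ _).symm

end

/-! ### Matching classes are deformations of each other -/

section
variable {n : ℕ} {Θ Θ' : IrregularClass n}

theorem exists_realizes (Θ : IrregularClass n) :
    ∃ p : Circles Θ → ExpFactor, (∀ I, circle (p I) = I.1) ∧
      Realizes (fun I : Circles Θ => I.1.levelDatum) (fun I J => I.1.fissionExponent J.1) p := by
  obtain ⟨p, hp, hs⟩ := exists_compatible_representatives Θ.1.support
  refine ⟨fun I => p I.1, fun I => hp I.1, fun I => ?_, fun I J => ?_, fun I J u => ?_⟩
  · rw [adapted_iff, hp]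
  · exact (hs I.1 I.2 J.1 J.2).le
  · have := StokesCircle.fissionExponent_le (rotate u (p I.1)) (p J.1)
    rwa [circle_rotate, hp, hp] at this

theorem classOf_circles (Θ : IrregularClass n) {p : Circles Θ → ExpFactor}
    (hp : ∀ I, circle (p I) = I.1) : classOf (fun I : Circles Θ => Θ.1 I.1) p = Θ.1 := by
  simp only [classOf, hp]
  rw [Finset.sum_coe_sort Θ.1.support (fun I => Finsupp.single I (Θ.1 I))]
  exact Finsupp.sum_single Θ.1

theorem CircleMatching.classOf_comp (M : CircleMatching Θ Θ') {p : Circles Θ' → ExpFactor}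
    (hp : ∀ I, circle (p I) = I.1) :
    classOf (fun I : Circles Θ => Θ.1 I.1) (fun I => p (M.e I)) = Θ'.1 := by
  rw [← classOf_circles Θ' hp, classOf, classOf,
    ← M.e.sum_comp fun J => Finsupp.single (circle (p J)) (Θ'.1 J.1)]
  simp only [M.mult]

/-- The real dimension of ℂ exceeds one, so removing a countable set leaves it connected. -/
theorem isConnected_compl_preimage_coord {S : Set ℂ} (hS : S.Finite) :
    IsConnected {x : EuclideanSpace ℂ (Fin 1) | x 0 ∉ S} := by
  have h1 : IsConnected Sᶜ := hS.countable.isConnected_compl_of_one_lt_rank (by simp)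
  have h2 : Continuous fun z : ℂ => (WithLp.toLp 2 fun _ => z : EuclideanSpace ℂ (Fin 1)) := by
    fun_prop
  convert h1.image _ h2.continuousOn using 1
  ext x
  constructor
  · intro hx
    refine ⟨x 0, hx, ?_⟩
    ext i
    rw [Subsingleton.elim i 0]
  · rintro ⟨z, hz, rfl⟩
    exact hz

theorem CircleMatching.isAdmissibleDeformation (M : CircleMatching Θ Θ') :
    IsAdmissibleDeformation Θ Θ' := by
  obtain ⟨p, hp, hr⟩ := exists_realizes Θ
  obtain ⟨p₁, hp₁, hr₁⟩ := exists_realizes Θ'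
  set L : Circles Θ → LevelDatum := fun I => I.1.levelDatum with hL
  set f : Circles Θ → Circles Θ → ℚ≥0 := fun I J => I.1.fissionExponent J.1 with hf
  set p' : Circles Θ → ExpFactor := fun I => p₁ (M.e I) with hp'
  -- Transported along the matching, the representatives of `Θ'` realize the level data and fission
  -- exponents of `Θ`.
  have hr' : Realizes L f p' :=
    { adapted := fun I =>
        (congrArg (fun D => D.Adapted (p' I)) (M.levels I)).mp (hr₁.adapted (M.e I))
      slope_le := fun I J => (hr₁.slope_le (M.e I) (M.e J)).trans_eq (M.fission I J)
      le_slope := fun I J u => (M.fission I J).symm.trans_le (hr₁.le_slope (M.e I) (M.e J) u) }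
  let N : Circles Θ → ℕ := fun I => Θ.1 I.1
  have hfin := hr.finite_not_realizes_lineThrough hr'
  set S := {t : ℂ | ¬ Realizes L f fun i => lineThrough (p i) (p' i) t} with hS
  -- The base is the line minus the finitely many bad parameters; `t = 0` and `t = 1` remain and
  -- give `Θ` and `Θ'`.
  let B : TopologicalSpace.Opens (EuclideanSpace ℂ (Fin 1)) :=
    ⟨{x | x 0 ∉ S}, hfin.isClosed.isOpen_compl.preimage (by fun_prop)⟩
  have hconn : IsConnected (B : Set (EuclideanSpace ℂ (Fin 1))) :=
    isConnected_compl_preimage_coord hfin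
  have hB : ∀ b : B, Realizes L f fun i => lineThrough (p i) (p' i) (b.1 0) := fun b =>
    not_not.1 b.2
  have hN : ∑ i, N i * (L i).ram = n := by
    rw [← rank_classOf N hr.adapted, classOf_circles Θ hp]
    exact Θ.2
  have hn : ∀ b : B, rank (classOf N fun i => lineThrough (p i) (p' i) (b.1 0)) = n := fun b => by
    rw [rank_classOf N (hB b).adapted, hN]
  have hmem : ∀ t, (Realizes L f fun i => lineThrough (p i) (p' i) t) →
      (WithLp.toLp 2 fun _ => t : EuclideanSpace ℂ (Fin 1)) ∈ B := fun t ht => not_not.2 ht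
  refine ⟨1, B, inferInstance, inferInstance, inferInstance, inferInstance,
    isConnected_iff_connectedSpace.1 hconn, inferInstance, _,
    isAdmissibleFamily_classOf N hB hn hN fun i k => ?_,
    ⟨_, hmem 0 (by simpa only [lineThrough_zero] using hr)⟩,
    ⟨_, hmem 1 (by simpa only [lineThrough_one] using hr')⟩, Subtype.ext ?_, Subtype.ext ?_⟩
  · have h1 : MDifferentiable 𝓘(ℂ, EuclideanSpace ℂ (Fin 1)) 𝓘(ℂ, EuclideanSpace ℂ (Fin 1))
        (Subtype.val : B → EuclideanSpace ℂ (Fin 1)) :=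
      (contMDiff_subtype_val (n := ω)).mdifferentiable (by simp)
    have h2 : Differentiable ℂ fun x : EuclideanSpace ℂ (Fin 1) =>
        lineThrough (p i) (p' i) (x 0) k := by
      simp only [lineThrough_apply]
      fun_prop
    exact h2.mdifferentiable.comp h1
  · simp only [lineThrough_zero]
    exact classOf_circles Θ hp
  · simp only [lineThrough_one]
    exact M.classOf_comp hp₁

end

end FissionTrees

open FissionTrees
theorem mainTheorem1 (n : ℕ) (Θ Θ' : IrregularClass n) :
    (IsAdmissibleDeformation Θ Θ' ↔ Nonempty ((fissionTree Θ).Iso (fissionTree Θ'))) ∧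
      (IsAdmissibleDeformation Θ Θ' ↔ fissionDatum Θ = fissionDatum Θ') := by
  have h : IsAdmissibleDeformation Θ Θ' ↔ fissionDatum Θ = fissionDatum Θ' :=
    ⟨fun h => h.fissionDatum_eq, fun h =>
      (nonempty_circleMatching_of_fissionDatum_eq h).some.isAdmissibleDeformation⟩
  refine ⟨h.trans ⟨fun h => ?_, fun ⟨E⟩ => ?_⟩, h⟩
  · exact ⟨(nonempty_circleMatching_of_fissionDatum_eq h).some.treeIso⟩
  · exact (nonempty_circleMatching_of_iso E).some.fissionDatum_eq
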